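/- Consider the scalar plant $x_{t+1}=a x_t+b u_t+w_t$, $t=0,1,2,\dots$, with $|a|>1$, $b\neq 0$, initial state $x_0\in(-x_{0,\max},x_{0,\max})$, $x_{0,\max}>0$, and i.i.d. zero-mean disturbances $w_t\in(-w_{\max},w_{\max})$ whose law has a density with respect to Lebesgue measure. The controller and the actuator communicate in blocks of $n\ge 1$ time slots with a codebook of $2^{nR}$ distinct codewords in $\mathbb C^n$, where $R>0$ and $2^{nR}$ is an integer (call such a pair $(n,R)$ admissible). At each time $t=kn$, $k\ge 0$, the controller chooses the codeword to be sent in the slots $kn+1,\dots,(k+1)n$ as a (measurable) function of the states $x_0,\dots,x_{kn}$, the codewords sent so far, and the correct/incorrect indications of their decoding. At each time $t=kn$, $k\ge 1$, the control action $u_{kn}$ is a function of those among the first $k$ codewords that were decoded correctly (erroneous ones are detected and discarded); $u_t=0$ at all other times. Each block is decoded incorrectly with probability $\epsilon(n,R)$, independently of the other blocks and of the disturbances. The stability region for the error probability $\epsilon(\cdot,\cdot)$ is the set of admissible pairs $(n,R)$ for which there are a codebook and such an encoder and decoder with $\limsup_{t\to\infty}\mathsf E|x_t|^2<\infty$ for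 every $x_0\in(-x_{0,\max},x_{0,\max})$. For $\mathsf{SNR}>0$ let $C=\log_2(1+\mathsf{SNR})$, $\nu=\mathsf{SNR}\,\frac{2+\mathsf{SNR}}{(1+\mathsf{SNR})^2}(\log_2 e)^2$, $Q(x)=\frac1{\sqrt{2\pi}}\int_x^\infty e^{-u^2/2}\,\mathrm du$, and let $\epsilon_{\mathrm{na}}(n,R)=Q\!\left(\sqrt{n/\nu}\,(C-R)\right)$ be the normal approximation of the minimum decoding-error probability on the AWGN channel, which is accurate for large blocklength. For a function $e(n,R)$ put $$\mathcal S(e)=\left\{(n,R):\ n\in\mathbb Z_+,\ R>0,\ e(n,R)\,a^{2n}+(1-e(n,R))\,\frac{a^{2n}}{2^{2nR}}<1\right\},\qquad \mathcal S=\mathcal S(\epsilon_{\mathrm{na}}).$$ (1) With the decoding-error probability given by the normal approximation, $\epsilon=\epsilon_{\mathrm{na}}$, the stability region of the plant is exactly the set of admissible pairs in $\mathcal S$. (2) Let the decoding-error probability $\epsilon(n,R)\in(0,1)$ of the codes in use satisfy $|\epsilon(n,R)-\epsilon_{\mathrm{na}}(n,R)|\le\delta(n,R)$ for all $n\ge n_0$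 and $R>0$. Then for all admissible $(n,R)$ with $n\ge n_0$: if $(n,R)\in\mathcal S(\epsilon_{\mathrm{na}}+\delta)$, then $(n,R)$ is in the stability region for $\epsilon$; and if $(n,R)$ is in the stability region for $\epsilon$, then $(n,R)\in\mathcal S(\epsilon_{\mathrm{na}}-\delta)$. -/

import Mathlib

open MeasureTheory Filter
open scoped ENNReal

namespace WNCS

noncomputable section

/-! ### The normal approximation for the AWGN channel -/

/-- The Gaussian tail function `Q(x) = (1/√(2π)) ∫_x^∞ exp(-u²/2) du`. -/
def qFun (x : ℝ) : ℝ :=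
  (√(2 * Real.pi))⁻¹ * ∫ u in Set.Ioi x, Real.exp (-(u ^ 2) / 2)

/-- Channel capacity `C = log₂ (1 + SNR)` (bits per complex channel use). -/
def capacity (snr : ℝ) : ℝ := Real.logb 2 (1 + snr)

/-- Channel dispersion `ν = SNR (2 + SNR) / (1 + SNR)² · (log₂ e)²`. -/
def dispersion (snr : ℝ) : ℝ :=
  snr * ((2 + snr) / (1 + snr) ^ 2) * (Real.logb 2 (Real.exp 1)) ^ 2

theorem qFun_mem (x : ℝ) : qFun x ∈ unitInterval := by
  have hi : Integrable (fun u : ℝ => Real.exp (-(u ^ 2) / 2)) := by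
    have := integrable_exp_neg_mul_sq (b := 1 / 2) (by norm_num)
    refine this.congr (ae_of_all _ fun u => ?_)
    show Real.exp _ = Real.exp _
    congr 1
    ring
  have ht : ∫ u : ℝ, Real.exp (-(u ^ 2) / 2) = √(2 * Real.pi) := by
    have h := integral_gaussian (1 / 2)
    have e : (fun u : ℝ => Real.exp (-(u ^ 2) / 2)) = fun u => Real.exp (-(1 / 2) * u ^ 2) := by
      funext u
      congr 1
      ring
    rw [e, h]
    congr 1
    ring
  have hp : 0 < √(2 * Real.pi) := Real.sqrt_pos.2 (by positivity)
  refine ⟨mul_nonneg (by positivity) (integral_nonneg fun u => (Real.exp_pos _).le), ?_⟩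
  have hle : ∫ u in Set.Ioi x, Real.exp (-(u ^ 2) / 2) ≤ √(2 * Real.pi) := by
    rw [← ht]
    exact setIntegral_le_integral hi (ae_of_all _ fun u => (Real.exp_pos _).le)
  unfold qFun
  calc (√(2 * Real.pi))⁻¹ * ∫ u in Set.Ioi x, Real.exp (-(u ^ 2) / 2)
      ≤ (√(2 * Real.pi))⁻¹ * √(2 * Real.pi) := by gcongr
    _ = 1 := inv_mul_cancel₀ hp.ne'

/-- Normal approximation of the minimum decoding-error probability at blocklength `n` and
rate `R`: `Q(√(n/ν) (C - R))`. -/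
def normalApprox (snr : ℝ) (n : ℕ+) (R : ℝ) : ℝ :=
  qFun (√((n : ℝ) / dispersion snr) * (capacity snr - R))

/-- The same number, as an element of `[0, 1]`. -/
def normalApproxErr (snr : ℝ) (n : ℕ+) (R : ℝ) : unitInterval :=
  ⟨normalApprox snr n R, qFun_mem _⟩

/-! ### Coding, quantization and control -/

/-- A codebook: `M` distinct codewords, each a sequence of `n` complex symbols. -/
abbrev Codebook (n : ℕ+) (M : ℕ) := Fin M ↪ (Fin n → ℂ)

/-- A quantization and control policy without memory constraint. Block `j` is the codeword sent
during the time slots `j n + 1, …, (j + 1) n`. -/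
structure Policy (n : ℕ+) (M : ℕ) where
  /-- At time `k n`: the index of the next codeword, as a function of the states
  `x_0, …, x_{k n}`, the `k` codewords sent so far, and their `k` acknowledgments. -/
  quantizer : (k : ℕ) → (Fin (k * n + 1) → ℝ) → (Fin k → (Fin n → ℂ)) → (Fin k → Bool) → Fin M
  /-- At time `k n`: the control action, as a function of the first `k` codewords, where a
  codeword that was not decoded correctly is discarded (`none`). -/
  decoder : (k : ℕ) → (Fin k → Option (Fin n → ℂ)) → ℝ
  /-- The quantizer is Borel measurable in the plant states. -/
  measurable_quantizer : ∀ k c s, Measurable fun x => quantizer k x c s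

section ClosedLoop

variable {n : ℕ+} {M : ℕ} (a b : ℝ) (cb : Codebook n M) (π : Policy n M) (x₀ : ℝ)
  (w : ℕ → ℝ) (s : ℕ → Bool)

mutual

/-- The plant state `x_t` for the disturbances `w_t` and the decoding outcomes `s`
(`s j = true` iff block `j` is decoded correctly): `x_{t+1} = a x_t + b u_t + w_t`. -/
def state : ℕ → ℝ
  | 0 => x₀
  | t + 1 => a * state t + b * action t + w t
termination_by t => 3 * t
decreasing_by all_goals omega

/-- The control action `u_t`: the decoder's output at the times `t = k n`, `k ≥ 1`, and zero
at all other times. -/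
def action (t : ℕ) : ℝ :=
  if 0 < t ∧ (n : ℕ) ∣ t then
    π.decoder (t / n) fun j => if s j then some (codeword j) else none
  else 0
termination_by 3 * t + 1
decreasing_by
  have h1 := j.isLt
  have h2 : (j : ℕ) + 1 ≤ t / n := h1
  have h3 : ((j : ℕ) + 1) * n ≤ t := le_trans (Nat.mul_le_mul_right _ h2) (Nat.div_mul_le_self t n)
  have h4 := n.pos
  rw [Nat.add_mul] at h3
  omega

/-- The codeword of block `k`, chosen at time `k n`. -/
def codeword (k : ℕ) : Fin n → ℂ :=
  cb (π.quantizer k (fun i => state i) (fun j => codeword j) (fun j => s j))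
termination_by 3 * (k * n) + 2
decreasing_by
  · have h1 := i.isLt
    omega
  · have h1 := j.isLt
    have h2 : ((j : ℕ) + 1) * n ≤ k * n := Nat.mul_le_mul_right _ h1
    have h4 := n.pos
    rw [Nat.add_mul] at h2
    omega

end

end ClosedLoop

/-- The joint law of the disturbances and the decoding outcomes: the `w_t` are i.i.d. with law
`μw`, the outcomes of the blocks are i.i.d. with failure probability `ε`, and the two sequences
are independent. -/
def noiseLaw (μw : Measure ℝ) (ε : unitInterval) : Measure ((ℕ → ℝ) × (ℕ → Bool)) :=
  (Measure.infinitePi fun _ : ℕ => μw).prod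
    (Measure.infinitePi fun _ : ℕ => ProbabilityTheory.bernoulliMeasure false true ε)

/-- The mean-square cost `limsup_{t → ∞} E |x_t|²`, as an extended nonnegative number. -/
def averageCost {n : ℕ+} {M : ℕ} (a b : ℝ) (μw : Measure ℝ) (ε : unitInterval)
    (cb : Codebook n M) (π : Policy n M) (x₀ : ℝ) : ℝ≥0∞ :=
  limsup (fun t : ℕ =>
    ∫⁻ ω, ENNReal.ofReal (state a b cb π x₀ ω.1 ω.2 t ^ 2) ∂(noiseLaw μw ε)) atTop

/-- `M = 2^{nR}` for some natural number `M`: there are codebooks of blocklength `n` and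
rate exactly `R`. -/
def IsCodebookSize (n : ℕ+) (R : ℝ) (M : ℕ) : Prop := (M : ℝ) = (2 : ℝ) ^ ((n : ℝ) * R)

/-- The stability region, when the codes of blocklength `n` and rate `R` have decoding-error
probability `ε n R`: the pairs `(n, R)` for which a codebook and a quantization and control policy
stabilize the plant in the mean-square sense from every initial state in `(-x0max, x0max)`. -/
def stabilityRegion (a b x0max : ℝ) (μw : Measure ℝ) (ε : ℕ+ → ℝ → unitInterval) :
    Set (ℕ+ × ℝ) :=
  {p | 0 < p.2 ∧ ∃ M : ℕ, IsCodebookSize p.1 p.2 M ∧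
    ∃ (cb : Codebook p.1 M) (π : Policy p.1 M), ∀ x₀ ∈ Set.Ioo (-x0max) x0max,
      averageCost a b μw (ε p.1 p.2) cb π x₀ < ⊤}

/-- The pairs `(n, R)` with `R > 0` and
`e(n,R) a^{2n} + (1 - e(n,R)) a^{2n} / 2^{2nR} < 1`. -/
def explicitRegion (a : ℝ) (e : ℕ+ → ℝ → ℝ) : Set (ℕ+ × ℝ) :=
  {p | 0 < p.2 ∧
    e p.1 p.2 * a ^ (2 * (p.1 : ℕ)) +
      (1 - e p.1 p.2) * (a ^ (2 * (p.1 : ℕ)) / (2 : ℝ) ^ (2 * (p.1 : ℝ) * p.2)) < 1}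

end

end WNCS

namespace WNCS

/-! ### Resampling one coordinate of an i.i.d. sequence -/

section Resampling

variable {X : Type*} [MeasurableSpace X] (μ : Measure X) [IsProbabilityMeasure μ]

-- Put `α = |a| ^ n`, `M = 2 ^ (nR)` and `ρ = ε α² + (1 - ε) α² / M²`. Everything rests on one
-- dichotomy: with `ε > 0`, mean-square stability is possible exactly when `ρ < 1`. In part (2) the
-- bounds are then transferred by monotonicity of `ρ` in the error probability
-- (`mem_explicitRegion_mono`).
--
-- Sufficiency. Encoder and actuator share an interval known to contain the state. Its midpoint is
-- cancelled by the control; its radius `L` becomes `α L + D` after an erasure and `α L / M + D`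
-- after a success, where `D` bounds the noise accumulated in a block. Young's inequality gives `E
-- L'² ≤ (1 + η) ρ E L² + const`, a contraction for small `η` (`exists_lintegral_trackRadius_le`).
--
-- Necessity, including the boundary `ρ = 1`. Let `τ_k(m)` be the mass of the state at time `kn`
-- that escapes every set of length `m`, summed over what the actuator may have received
-- (`receivedTail`). The plant stretches length by `|a|`, controls only translate, and a received
-- codeword splits a law into `M` pieces, so `τ_{k+1}(m) ≥ ε τ_k(m/α) + (1 - ε) τ_k(M m/α)`.
-- Integrating against `m` shows only that the second moment's lower bound is multiplied by `ρ`,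
-- which is inconclusive at `ρ = 1`. The remedy is the weight `(m - m₀²/m)⁺`. In the dual recursion
-- on weights, `m` is multiplied by `ρ ≥ 1`, while `1/m` is exactly invariant; hence the weight does
-- not decrease, and truncation at zero creates a strict gain just below `m₀`
-- (`harmonicWeight_step`). Because the noise has a density, `τ_k(m₀)` stays bounded below for `k ≥
-- 1`, so every block adds a fixed positive amount and the second moment diverges
-- (`averageCost_eq_top`).

theorem measurable_update_prod (t : ℕ) :
    Measurable fun p : (ℕ → X) × X => Function.update p.1 t p.2 := by
  refine measurable_pi_lambda _ fun i => ?_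
  by_cases h : i = t
  · subst h; simpa using measurable_snd
  · simp only [Function.update_of_ne h]
    exact (measurable_pi_apply i).comp measurable_fst

/-- Replacing one coordinate by a fresh independent copy preserves an i.i.d. law. This takes the
place of conditional expectations: averaging over a single disturbance or decoding outcome is done
by resampling it. -/
theorem map_update_infinitePi (t : ℕ) :
    ((Measure.infinitePi fun _ : ℕ => μ).prod μ).map
      (fun p => Function.update p.1 t p.2) = Measure.infinitePi fun _ : ℕ => μ := by
  refine Measure.eq_infinitePi _ fun s A hA => ?_
  rw [Measure.map_apply (measurable_update_prod t)
    (MeasurableSet.pi s.countable_toSet fun i _ => hA i)]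
  by_cases ht : t ∈ s
  · have : (fun p : (ℕ → X) × X => Function.update p.1 t p.2) ⁻¹' (Set.pi s A) =
        (Set.pi (s.erase t : Finset ℕ) A) ×ˢ A t := by
      ext p
      simp only [Set.mem_preimage, Set.mem_pi, Set.mem_prod, Finset.mem_coe, Finset.mem_erase]
      constructor
      · intro h
        refine ⟨fun i hi => ?_, ?_⟩
        · simpa [Function.update_of_ne hi.1] using h i hi.2
        · simpa using h t ht
      · rintro ⟨h1, h2⟩ i hi
        by_cases e : i = t
        · subst e; simpa using h2
        · simpa [Function.update_of_ne e] using h1 i ⟨e, hi⟩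
    rw [this, Measure.prod_prod, Measure.infinitePi_pi _ fun i _ => hA i,
      Finset.prod_erase_mul _ _ ht]
  · have : (fun p : (ℕ → X) × X => Function.update p.1 t p.2) ⁻¹' (Set.pi s A) =
        (Set.pi s A) ×ˢ Set.univ := by
      ext p
      simp only [Set.mem_preimage, Set.mem_pi, Set.mem_prod, Finset.mem_coe, Set.mem_univ,
        and_true]
      refine forall₂_congr fun i hi => ?_
      rw [Function.update_of_ne (by rintro rfl; exact ht hi)]
    rw [this, Measure.prod_prod, Measure.infinitePi_pi _ fun i _ => hA i, measure_univ, mul_one]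

theorem lintegral_infinitePi_update (t : ℕ) {f : (ℕ → X) → ℝ≥0∞} (hf : Measurable f) :
    ∫⁻ x, f x ∂(Measure.infinitePi fun _ : ℕ => μ) =
      ∫⁻ x, ∫⁻ v, f (Function.update x t v) ∂μ ∂(Measure.infinitePi fun _ : ℕ => μ) := by
  conv_lhs => rw [← map_update_infinitePi μ t]
  rw [lintegral_map hf (measurable_update_prod t),
    lintegral_prod (fun p : (ℕ → X) × X => f (Function.update p.1 t p.2))
      (hf.comp (measurable_update_prod t)).aemeasurable]

end Resampling

section NoiseLaw

variable (μw : Measure ℝ) (ε : unitInterval)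

theorem lintegral_bernoulli (f : Bool → ℝ≥0∞) :
    ∫⁻ v, f v ∂(ProbabilityTheory.bernoulliMeasure false true ε) =
      ENNReal.ofReal ε * f false + ENNReal.ofReal (1 - ε) * f true := by
  rw [ProbabilityTheory.bernoulliMeasure_def, lintegral_add_measure, lintegral_smul_measure,
    lintegral_smul_measure, lintegral_dirac, lintegral_dirac]
  have h1 : ENNReal.ofReal (ε : ℝ) = (unitInterval.toNNReal ε : ℝ≥0∞) := by
    rw [ENNReal.ofReal, ENNReal.coe_inj]; ext; simp [ε.2.1]
  have h2 : ENNReal.ofReal (1 - (ε : ℝ)) =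
      (unitInterval.toNNReal (unitInterval.symm ε) : ℝ≥0∞) := by
    rw [ENNReal.ofReal, ENNReal.coe_inj]; ext; simp [ε.2.2]
  rw [h1, h2]
  rfl

theorem lintegral_noiseLaw_update_snd (k : ℕ) {f : (ℕ → ℝ) × (ℕ → Bool) → ℝ≥0∞}
    (hf : Measurable f) :
    ∫⁻ ω, f ω ∂(noiseLaw μw ε) =
      ∫⁻ ω, (ENNReal.ofReal ε * f (ω.1, Function.update ω.2 k false) +
        ENNReal.ofReal (1 - ε) * f (ω.1, Function.update ω.2 k true)) ∂(noiseLaw μw ε) := by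
  have hm : ∀ v, Measurable fun p : (ℕ → ℝ) × (ℕ → Bool) =>
      f (p.1, Function.update p.2 k v) := fun v =>
    hf.comp (measurable_fst.prodMk ((measurable_update_prod k).comp
      (measurable_snd.prodMk measurable_const)))
  unfold noiseLaw
  rw [lintegral_prod _ hf.aemeasurable, lintegral_prod
    (fun p : (ℕ → ℝ) × (ℕ → Bool) => ENNReal.ofReal ε * f (p.1, Function.update p.2 k false) +
        ENNReal.ofReal (1 - ε) * f (p.1, Function.update p.2 k true))
    (((hm false).const_mul _).add ((hm true).const_mul _)).aemeasurable]
  refine lintegral_congr fun x => ?_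
  rw [lintegral_infinitePi_update _ k (f := fun s => f (x, s))
    (hf.comp (measurable_const.prodMk measurable_id))]
  refine lintegral_congr fun s => ?_
  rw [lintegral_bernoulli]

variable [IsProbabilityMeasure μw]

instance : IsProbabilityMeasure (noiseLaw μw ε) := by
  unfold noiseLaw; infer_instance

theorem lintegral_noiseLaw_update_fst (t : ℕ) {f : (ℕ → ℝ) × (ℕ → Bool) → ℝ≥0∞}
    (hf : Measurable f) :
    ∫⁻ ω, f ω ∂(noiseLaw μw ε) =
      ∫⁻ ω, ∫⁻ v, f (Function.update ω.1 t v, ω.2) ∂μw ∂(noiseLaw μw ε) := by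
  have hm : Measurable fun p : ((ℕ → ℝ) × (ℕ → Bool)) × ℝ =>
      f (Function.update p.1.1 t p.2, p.1.2) :=
    hf.comp (((measurable_update_prod t).comp
      ((measurable_fst.comp measurable_fst).prodMk measurable_snd)).prodMk
      (measurable_snd.comp measurable_fst))
  unfold noiseLaw
  rw [lintegral_prod_symm' _ hf, lintegral_prod_symm' _ hm.lintegral_prod_right']
  refine lintegral_congr fun s => ?_
  exact lintegral_infinitePi_update μw t (f := fun x => f (x, s))
    (hf.comp (measurable_id.prodMk measurable_const))

end NoiseLaw

/-! ### Causality and measurability of the closed loop -/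

section ClosedLoop

variable {n : ℕ+} {M : ℕ} (a b : ℝ) (cb : Codebook n M) (π : Policy n M) (x₀ : ℝ)

theorem mul_lt_of_lt_div {j t : ℕ} (h : j < t / n) : j * n < t :=
  lt_of_lt_of_le (Nat.mul_lt_mul_of_pos_right h n.pos) (Nat.div_mul_le_self t n)

theorem state_zero (w : ℕ → ℝ) (s : ℕ → Bool) : state a b cb π x₀ w s 0 = x₀ := by
  rw [state]

theorem state_succ (w : ℕ → ℝ) (s : ℕ → Bool) (t : ℕ) :
    state a b cb π x₀ w s (t + 1) =
      a * state a b cb π x₀ w s t + b * action a b cb π x₀ w s t + w t := by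
  rw [state]

/-- The index of the codeword sent in block `k`. -/
noncomputable def message (w : ℕ → ℝ) (s : ℕ → Bool) (k : ℕ) : Fin M :=
  π.quantizer k (fun i => state a b cb π x₀ w s i) (fun j => codeword a b cb π x₀ w s j)
    (fun j => s j)

theorem codeword_eq (w : ℕ → ℝ) (s : ℕ → Bool) (k : ℕ) :
    codeword a b cb π x₀ w s k = cb (message a b cb π x₀ w s k) := by
  rw [codeword, message]

/-- The indices of the correctly decoded ones among the first `k` codewords. -/
noncomputable def received (w : ℕ → ℝ) (s : ℕ → Bool) (k : ℕ) : Fin k → Option (Fin M) :=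
  fun j => if s j then some (message a b cb π x₀ w s j) else none

/-- The control action at time `t` for the decoded indices `h`. -/
noncomputable def control (t : ℕ) (h : Fin (t / n) → Option (Fin M)) : ℝ :=
  if 0 < t ∧ (n : ℕ) ∣ t then π.decoder (t / n) fun j => (h j).map cb else 0

theorem action_eq (w : ℕ → ℝ) (s : ℕ → Bool) (t : ℕ) :
    action a b cb π x₀ w s t = control cb π t (received a b cb π x₀ w s (t / n)) := by
  rw [action, control]
  simp only [received, codeword_eq]
  congr 1
  congr 1
  funext j
  split_ifs <;> rfl

-- Causality. States and messages feed each other, so both are handled in one strong induction on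
-- time; the message of block `k` belongs to time `k n`, after the state there.
variable {a b cb π x₀} in
theorem state_message_congr {w w' : ℕ → ℝ} {s s' : ℕ → Bool} (T : ℕ)
    (hw : ∀ i < T, w i = w' i) (hs : ∀ j : ℕ, j * n < T → s j = s' j) :
    state a b cb π x₀ w s T = state a b cb π x₀ w' s' T ∧
      ∀ k : ℕ, k * n = T → message a b cb π x₀ w s k = message a b cb π x₀ w' s' k := by
  induction T using Nat.strong_induction_on with
  | _ T ih =>
    have hst : ∀ t < T, state a b cb π x₀ w s t = state a b cb π x₀ w' s' t := fun t ht =>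
      (ih t ht (fun i hi => hw i (hi.trans ht)) fun j hj => hs j (hj.trans ht)).1
    have hms : ∀ j : ℕ, j * n < T →
        message a b cb π x₀ w s j = message a b cb π x₀ w' s' j := fun j ht =>
      (ih _ ht (fun i hi => hw i (hi.trans ht)) fun j hj => hs j (hj.trans ht)).2 j rfl
    have h1 : state a b cb π x₀ w s T = state a b cb π x₀ w' s' T := by
      cases T with
      | zero => rw [state_zero, state_zero]
      | succ t =>
        rw [state_succ, state_succ, hst t t.lt_succ_self, hw t t.lt_succ_self, action_eq,
          action_eq]
        congr 4
        funext j
        have hj : (j : ℕ) * n < t + 1 := (mul_lt_of_lt_div j.2).trans t.lt_succ_self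
        simp only [received, hs j hj, hms j hj]
    refine ⟨h1, fun k hk => ?_⟩
    subst hk
    have hj : ∀ j : Fin k, (j : ℕ) * n < k * n := fun j =>
      Nat.mul_lt_mul_of_pos_right j.2 n.pos
    unfold message
    congr 1
    · funext i
      rcases (Nat.lt_succ_iff.1 i.2).lt_or_eq with h | h
      · exact hst _ h
      · rw [h]; exact h1
    · funext j; rw [codeword_eq, codeword_eq, hms j (hj j)]
    · funext j; exact hs j (hj j)

variable {a b cb π x₀} in
theorem state_congr {w w' : ℕ → ℝ} {s s' : ℕ → Bool} {T : ℕ}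
    (hw : ∀ i < T, w i = w' i) (hs : ∀ j : ℕ, j * n < T → s j = s' j) :
    state a b cb π x₀ w s T = state a b cb π x₀ w' s' T :=
  (state_message_congr T hw hs).1

variable {a b cb π x₀} in
theorem message_congr {w w' : ℕ → ℝ} {s s' : ℕ → Bool} {k : ℕ}
    (hw : ∀ i < k * n, w i = w' i) (hs : ∀ j < k, s j = s' j) :
    message a b cb π x₀ w s k = message a b cb π x₀ w' s' k :=
  (state_message_congr (k * n) hw fun j hj => hs j (Nat.lt_of_mul_lt_mul_right hj)).2 k rfl

-- The last of the `k` codewords is already chosen at time `(k - 1) n`, so no disturbance from that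
-- time on can affect what is received.
variable {a b cb π x₀} in
theorem received_congr {w w' : ℕ → ℝ} {s s' : ℕ → Bool} {k : ℕ}
    (hw : ∀ i, i + n < k * n → w i = w' i) (hs : ∀ j < k, s j = s' j) :
    received a b cb π x₀ w s k = received a b cb π x₀ w' s' k := by
  funext j
  have hj := Nat.mul_le_mul_right (n : ℕ) (Nat.succ_le_of_lt j.2)
  rw [Nat.succ_mul] at hj
  simp only [received, hs j j.2]
  rw [message_congr (fun i hi => hw i (by omega)) fun i hi => hs i (hi.trans j.2)]

variable {a b cb π x₀} in
theorem measurable_comp_received_of {k : ℕ} {Y : Type*} [MeasurableSpace Y]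
    (hm : ∀ j < k, Measurable fun ω : (ℕ → ℝ) × (ℕ → Bool) => message a b cb π x₀ ω.1 ω.2 j)
    (f : (Fin k → Option (Fin M)) → Y) :
    Measurable fun ω : (ℕ → ℝ) × (ℕ → Bool) => f (received a b cb π x₀ ω.1 ω.2 k) := by
  have hF : Measurable fun p : (Fin k → Fin M) × (Fin k → Bool) =>
      f fun j => if p.2 j then some (p.1 j) else none := Measurable.of_discrete
  have h1 : Measurable fun ω : (ℕ → ℝ) × (ℕ → Bool) =>
      fun j : Fin k => message a b cb π x₀ ω.1 ω.2 j :=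
    measurable_pi_lambda _ fun j => hm j j.2
  have h2 : Measurable fun ω : (ℕ → ℝ) × (ℕ → Bool) => fun j : Fin k => ω.2 j :=
    measurable_pi_lambda _ fun j => (measurable_pi_apply (j : ℕ)).comp measurable_snd
  exact hF.comp (h1.prodMk h2)

theorem measurable_state_message (T : ℕ) :
    (Measurable fun ω : (ℕ → ℝ) × (ℕ → Bool) => state a b cb π x₀ ω.1 ω.2 T) ∧
      ∀ k : ℕ, k * n = T →
        Measurable fun ω : (ℕ → ℝ) × (ℕ → Bool) => message a b cb π x₀ ω.1 ω.2 k := by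
  induction T using Nat.strong_induction_on with
  | _ T ih =>
    have hs : ∀ j : ℕ, Measurable fun ω : (ℕ → ℝ) × (ℕ → Bool) => ω.2 j := fun j =>
      (measurable_pi_apply j).comp measurable_snd
    have h1 : Measurable fun ω : (ℕ → ℝ) × (ℕ → Bool) => state a b cb π x₀ ω.1 ω.2 T := by
      cases T with
      | zero => simp only [state_zero]; exact measurable_const
      | succ t =>
        simp only [state_succ, action_eq]
        have hc : Measurable fun ω : (ℕ → ℝ) × (ℕ → Bool) =>
            control cb π t (received a b cb π x₀ ω.1 ω.2 (t / n)) := by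
          refine measurable_comp_received_of (fun j hj => ?_) _
          exact (ih _ ((mul_lt_of_lt_div hj).trans t.lt_succ_self)).2 j rfl
        exact (((ih t t.lt_succ_self).1.const_mul a).add (hc.const_mul b)).add
          ((measurable_pi_apply t).comp measurable_fst)
    refine ⟨h1, fun k hk => ?_⟩
    subst hk
    -- Past messages and acknowledgments range over a finite set, so measurability in the states
    -- alone gives joint measurability.
    have hQ : Measurable fun p : ((Fin k → Fin M) × (Fin k → Bool)) × (Fin (k * n + 1) → ℝ) =>
        π.quantizer k p.2 (fun j => cb (p.1.1 j)) p.1.2 :=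
      measurable_from_prod_countable_right fun p =>
        π.measurable_quantizer k (fun j => cb (p.1 j)) p.2
    have hx : Measurable fun ω : (ℕ → ℝ) × (ℕ → Bool) =>
        fun i : Fin (k * n + 1) => state a b cb π x₀ ω.1 ω.2 i := by
      refine measurable_pi_lambda _ fun i => ?_
      rcases (Nat.lt_succ_iff.1 i.2).lt_or_eq with h | h
      · exact (ih _ h).1
      · rw [h]; exact h1
    have hc : Measurable fun ω : (ℕ → ℝ) × (ℕ → Bool) =>
        fun j : Fin k => message a b cb π x₀ ω.1 ω.2 j :=
      measurable_pi_lambda _ fun j => (ih _ (Nat.mul_lt_mul_of_pos_right j.2 n.pos)).2 j rfl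
    have hb : Measurable fun ω : (ℕ → ℝ) × (ℕ → Bool) => fun j : Fin k => ω.2 j :=
      measurable_pi_lambda _ fun j => hs j
    have := hQ.comp ((hc.prodMk hb).prodMk hx)
    convert this using 1
    funext ω
    rw [message]
    simp only [codeword_eq]
    rfl

theorem measurable_state (T : ℕ) :
    Measurable fun ω : (ℕ → ℝ) × (ℕ → Bool) => state a b cb π x₀ ω.1 ω.2 T :=
  (measurable_state_message a b cb π x₀ T).1

theorem measurable_message (k : ℕ) :
    Measurable fun ω : (ℕ → ℝ) × (ℕ → Bool) => message a b cb π x₀ ω.1 ω.2 k :=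
  (measurable_state_message a b cb π x₀ (k * n)).2 k rfl

variable {a b cb π x₀} in
theorem measurable_comp_received {k : ℕ} {Y : Type*} [MeasurableSpace Y]
    (f : (Fin k → Option (Fin M)) → Y) :
    Measurable fun ω : (ℕ → ℝ) × (ℕ → Bool) => f (received a b cb π x₀ ω.1 ω.2 k) :=
  measurable_comp_received_of (fun j _ => measurable_message a b cb π x₀ j) f

theorem measurableSet_received {k : ℕ} (h : Fin k → Option (Fin M)) :
    MeasurableSet {ω : (ℕ → ℝ) × (ℕ → Bool) | received a b cb π x₀ ω.1 ω.2 k = h} :=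
  (measurable_comp_received (fun g => g = h)).setOf

end ClosedLoop

/-! ### Mass that escapes every set of a given length -/

/-- The least mass that `μ` leaves outside a set of length at most `m`. -/
noncomputable def tailMass (μ : Measure ℝ) (m : ℝ) : ℝ≥0∞ :=
  ⨅ (A : Set ℝ) (_ : MeasurableSet A) (_ : volume A ≤ ENNReal.ofReal m), μ Aᶜ

theorem tailMass_le {μ : Measure ℝ} {m : ℝ} {A : Set ℝ} (hA : MeasurableSet A)
    (hv : volume A ≤ ENNReal.ofReal m) : tailMass μ m ≤ μ Aᶜ :=
  iInf_le_of_le A (iInf_le_of_le hA (iInf_le_of_le hv le_rfl))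

theorem le_tailMass_iff {μ : Measure ℝ} {m : ℝ} {c : ℝ≥0∞} :
    c ≤ tailMass μ m ↔
      ∀ A, MeasurableSet A → volume A ≤ ENNReal.ofReal m → c ≤ μ Aᶜ := by
  simp only [tailMass, le_iInf_iff]

theorem antitone_tailMass (μ : Measure ℝ) : Antitone (tailMass μ) := fun _ _ h =>
  le_tailMass_iff.2 fun _ hA hv => tailMass_le hA (hv.trans (ENNReal.ofReal_le_ofReal h))

theorem tailMass_le_measure_abs (μ : Measure ℝ) (m : ℝ) :
    tailMass μ m ≤ μ {x | m / 2 < |x|} := by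
  refine (tailMass_le (A := Set.Icc (-(m / 2)) (m / 2)) measurableSet_Icc ?_).trans ?_
  · rw [Real.volume_Icc]; exact ENNReal.ofReal_le_ofReal (by linarith)
  · refine measure_mono fun x hx => ?_
    simp only [Set.mem_compl_iff, Set.mem_Icc, Set.mem_ofPred_eq] at hx ⊢
    by_contra h
    exact hx (abs_le.1 (not_lt.1 h))

theorem mul_tailMass_le (μ : Measure ℝ) (c : ℝ≥0∞) (m : ℝ) :
    c * tailMass μ m ≤ tailMass (c • μ) m :=
  le_tailMass_iff.2 fun _ hA hv => by
    rw [Measure.smul_apply, smul_eq_mul]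
    gcongr
    exact tailMass_le hA hv

/-- The union of one good set per piece is at most `card ι` times as long and serves all pieces at
once. This is how `M` codewords buy a factor `M` in length. -/
theorem tailMass_sum_le {ι : Type*} [Fintype ι] (μ : ι → Measure ℝ) (m : ℝ) :
    tailMass (∑ i, μ i) (Fintype.card ι * m) ≤ ∑ i, tailMass (μ i) m := by
  by_cases htop : ∃ i, tailMass (μ i) m = ⊤
  · obtain ⟨i, hi⟩ := htop
    rw [(ENNReal.sum_eq_top (s := Finset.univ)).2 ⟨i, Finset.mem_univ i, hi⟩]
    exact le_top
  push Not at htop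
  -- The infimum need not be attained, so near-optimal sets are used, with the slack shared equally
  -- among the pieces.
  refine ENNReal.le_of_forall_pos_le_add fun δ hδ _ => ?_
  have hex : ∀ i, ∃ A, MeasurableSet A ∧ volume A ≤ ENNReal.ofReal m ∧
      μ i Aᶜ ≤ tailMass (μ i) m + δ / Fintype.card ι := by
    intro i
    by_contra! hcon
    have h1 : tailMass (μ i) m + δ / Fintype.card ι ≤ tailMass (μ i) m :=
      le_tailMass_iff.2 fun A hA hv => (hcon A hA hv).le
    have h2 : (δ : ℝ≥0∞) / Fintype.card ι ≠ 0 :=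
      (ENNReal.div_pos (by exact_mod_cast hδ.ne') (ENNReal.natCast_ne_top _)).ne'
    exact absurd h1 (not_le.2 (ENNReal.lt_add_right (htop i) h2))
  choose A hA hv hμ using hex
  have hvol : volume (⋃ i, A i) ≤ ENNReal.ofReal (Fintype.card ι * m) := by
    calc volume (⋃ i, A i) ≤ ∑ i, volume (A i) := measure_iUnion_fintype_le _ _
      _ ≤ ∑ _i : ι, ENNReal.ofReal m := Finset.sum_le_sum fun i _ => hv i
      _ = ENNReal.ofReal (Fintype.card ι * m) := by
        rw [Finset.sum_const, Finset.card_univ, nsmul_eq_mul,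
          ENNReal.ofReal_mul (Nat.cast_nonneg _), ENNReal.ofReal_natCast]
  refine (tailMass_le (MeasurableSet.iUnion hA) hvol).trans ?_
  rw [Measure.finsetSum_apply]
  calc ∑ i, μ i (⋃ i, A i)ᶜ ≤ ∑ i, (tailMass (μ i) m + δ / Fintype.card ι) :=
        Finset.sum_le_sum fun i _ =>
          (measure_mono (Set.compl_subset_compl.2 (Set.subset_iUnion A i))).trans (hμ i)
    _ ≤ ∑ i, tailMass (μ i) m + δ := by
        rw [Finset.sum_add_distrib, Finset.sum_const, Finset.card_univ, nsmul_eq_mul]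
        gcongr
        exact ENNReal.mul_div_le

-- Effect of one plant step on escaping mass

section AffineNoise

variable {μ ν : Measure ℝ} {a c m : ℝ}

theorem measurableSet_affineNoise {B : Set ℝ} (hB : MeasurableSet B) :
    MeasurableSet {p : ℝ × ℝ | a * p.1 + c + p.2 ∈ B} :=
  (((measurable_fst.const_mul a).add_const c).add measurable_snd) hB

/-- With the noise value frozen, the preimage of a set under the affine map has its length divided
by `|a|`; the bound does not depend on the frozen value and survives averaging. -/
theorem tailMass_div_le_of_affineNoise [IsFiniteMeasure μ] [IsProbabilityMeasure ν]
    (ha : a ≠ 0) {μ' : Measure ℝ}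
    (h : ∀ B, MeasurableSet B → μ' B = μ.prod ν {p : ℝ × ℝ | a * p.1 + c + p.2 ∈ B}) :
    tailMass μ (m / |a|) ≤ tailMass μ' m := by
  refine le_tailMass_iff.2 fun A hA hv => ?_
  rw [h _ hA.compl, Measure.prod_apply_symm (measurableSet_affineNoise hA.compl)]
  calc tailMass μ (m / |a|) = ∫⁻ _, tailMass μ (m / |a|) ∂ν := by simp
    _ ≤ _ := by
      refine lintegral_mono fun v => ?_
      have he : ((fun y => (y, v)) ⁻¹' {p : ℝ × ℝ | a * p.1 + c + p.2 ∈ Aᶜ}) =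
          ((fun y => a * y) ⁻¹' ((fun z => z + (c + v)) ⁻¹' A))ᶜ := by
        ext y; simp [add_assoc]
      have hm : MeasurableSet ((fun z : ℝ => z + (c + v)) ⁻¹' A) :=
        (measurable_add_const _) hA
      rw [he]
      refine tailMass_le ((measurable_const_mul a) hm) ?_
      rw [Real.volume_preimage_mul_left ha, measure_preimage_add_right, abs_inv, div_eq_inv_mul,
        ENNReal.ofReal_mul (by positivity)]
      gcongr

/-- Here the state is frozen instead: the new state is then a translate of the noise, and
translations preserve length. -/
theorem measure_univ_mul_tailMass_le_of_affineNoise [IsFiniteMeasure μ] [IsProbabilityMeasure ν]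
    {μ' : Measure ℝ}
    (h : ∀ B, MeasurableSet B → μ' B = μ.prod ν {p : ℝ × ℝ | a * p.1 + c + p.2 ∈ B}) :
    μ Set.univ * tailMass ν m ≤ tailMass μ' m := by
  refine le_tailMass_iff.2 fun A hA hv => ?_
  rw [h _ hA.compl, Measure.prod_apply (measurableSet_affineNoise hA.compl)]
  calc μ Set.univ * tailMass ν m = ∫⁻ _, tailMass ν m ∂μ := by simp [mul_comm]
    _ ≤ _ := by
      refine lintegral_mono fun y => ?_
      have he : (Prod.mk y ⁻¹' {p : ℝ × ℝ | a * p.1 + c + p.2 ∈ Aᶜ}) =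
          ((fun z => a * y + c + z) ⁻¹' A)ᶜ := by
        ext y; simp
      rw [he]
      refine tailMass_le ((measurable_const_add _) hA) ?_
      rwa [measure_preimage_add]

end AffineNoise

/-- The integral of a density is uniformly absolutely continuous, so sets that are short enough
carry mass below one half. -/
theorem exists_tailMass_pos {ν : Measure ℝ} [IsProbabilityMeasure ν] (h : ν ≪ volume) :
    ∃ m > 0, 0 < tailMass ν m := by
  have hd : volume.withDensity (ν.rnDeriv volume) = ν := Measure.withDensity_rnDeriv_eq ν volume h
  have hfin : ∫⁻ x, ν.rnDeriv volume x ≠ ⊤ := by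
    rw [← setLIntegral_univ, ← withDensity_apply _ MeasurableSet.univ, hd]
    exact measure_ne_top _ _
  obtain ⟨δ, hδ, hs⟩ := exists_pos_setLIntegral_lt_of_measure_lt hfin (ε := 2⁻¹) (by simp)
  obtain ⟨r, hr0, hrδ⟩ := ENNReal.lt_iff_exists_nnreal_btwn.1 hδ
  refine ⟨r, by exact_mod_cast hr0, lt_of_lt_of_le (b := 2⁻¹) (by simp) ?_⟩
  refine le_tailMass_iff.2 fun A hA hv => ?_
  rw [ENNReal.ofReal_coe_nnreal] at hv
  have h1 := hs A (hv.trans_lt hrδ)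
  rw [← withDensity_apply _ hA, hd] at h1
  rw [prob_compl_eq_one_sub hA, ← ENNReal.one_sub_inv_two]
  exact tsub_le_tsub_left h1.le _

/-! ### Divergence of a weighted integral of the tail masses -/

/-- The substitution `m ↦ r m` moves a dilation from the tail to the weight, turning the recursion
for tails into its dual on weights. -/
theorem lintegral_Ioi_mul_comp_div {r : ℝ} (hr : 0 < r) {f g : ℝ → ℝ≥0∞} (hf : Measurable f)
    (hg : Measurable g) :
    ∫⁻ m in Set.Ioi 0, f m * g (m / r) =
      ∫⁻ m in Set.Ioi 0, ENNReal.ofReal r * f (r * m) * g m := by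
  have hF : Measurable fun m => f m * g (m / r) := hf.mul (hg.comp (measurable_id.div_const r))
  rw [← lintegral_indicator measurableSet_Ioi, ← lintegral_indicator measurableSet_Ioi]
  conv_lhs => rw [← Real.smul_map_volume_mul_left hr.ne']
  rw [lintegral_smul_measure, lintegral_map (hF.indicator measurableSet_Ioi)
    (measurable_const_mul r), abs_of_pos hr, smul_eq_mul,
    ← lintegral_const_mul _ (f := fun m => (Set.Ioi 0).indicator (fun m => f m * g (m / r)) (r * m))
      ((hF.indicator measurableSet_Ioi).comp (measurable_const_mul r))]
  refine lintegral_congr fun m => ?_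
  by_cases hm : 0 < m
  · rw [Set.indicator_of_mem (Set.mem_Ioi.2 hm), Set.indicator_of_mem
      (Set.mem_Ioi.2 (mul_pos hr hm)), mul_div_cancel_left₀ _ hr.ne', mul_assoc]
  · have hrm : ¬0 < r * m := fun h => hm (pos_of_mul_pos_right h hr.le)
    rw [Set.indicator_of_notMem (by simpa using hrm), Set.indicator_of_notMem (by simpa using hm),
      mul_zero]

/-- The dual operator `φ ↦ ε α φ(α m) + (1 - ε) (α/M) φ(α m/M)` multiplies `m` by the left side of
`hρ`'s bound on `1` and fixes `1/m`. Below `m₀` the truncated weight vanishes, but an erasure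
carries points `m > m₀/α` to where it is positive. The indicator starts at the midpoint of `m₀/α`
and `m₀`, which keeps this gain bounded below. -/
theorem harmonicWeight_step {α M ε m₀ m : ℝ} (hα : 1 < α) (hM : 0 < M) (hε : 0 < ε) (hε1 : ε ≤ 1)
    (hρ : 1 ≤ ε * α ^ 2 + (1 - ε) * (α ^ 2 / M ^ 2)) (hm₀ : 0 < m₀) (hm : 0 < m) :
    ENNReal.ofReal (m - m₀ ^ 2 / m) +
        (Set.Ioc (m₀ * (1 + 1 / α) / 2) m₀).indicator
          (fun _ => ENNReal.ofReal (ε * (m₀ * (((α + 1) / 2) ^ 2 - 1)))) m ≤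
      ENNReal.ofReal ε * (ENNReal.ofReal α * ENNReal.ofReal (α * m - m₀ ^ 2 / (α * m))) +
      ENNReal.ofReal (1 - ε) * (ENNReal.ofReal (α / M) *
        ENNReal.ofReal (α / M * m - m₀ ^ 2 / (α / M * m))) := by
  have hα0 : 0 < α := by linarith
  by_cases hmm : m ≤ m₀
  · have h0 : m - m₀ ^ 2 / m ≤ 0 := by
      rw [sub_nonpos, le_div_iff₀ hm]; nlinarith
    rw [ENNReal.ofReal_of_nonpos h0, zero_add]
    refine le_trans ?_ le_self_add
    by_cases hmem : m ∈ Set.Ioc (m₀ * (1 + 1 / α) / 2) m₀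
    · rw [Set.indicator_of_mem hmem, ← ENNReal.ofReal_mul hα0.le, ← ENNReal.ofReal_mul hε.le]
      refine ENNReal.ofReal_le_ofReal (mul_le_mul_of_nonneg_left ?_ hε.le)
      have e : α * (α * m - m₀ ^ 2 / (α * m)) = ((α * m) ^ 2 - m₀ ^ 2) / m := by
        field_simp
      have h1 : m₀ * ((α + 1) / 2) ≤ α * m := by
        have := hmem.1.le
        calc m₀ * ((α + 1) / 2) = α * (m₀ * (1 + 1 / α) / 2) := by field_simp
          _ ≤ α * m := by gcongr
      have h2 : (m₀ * ((α + 1) / 2)) ^ 2 ≤ (α * m) ^ 2 := by gcongr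
      have h3 : 0 ≤ m₀ * (((α + 1) / 2) ^ 2 - 1) := mul_nonneg hm₀.le (by nlinarith)
      rw [e, le_div_iff₀ hm]
      nlinarith [mul_le_mul_of_nonneg_left hmm h3]
    · rw [Set.indicator_of_notMem hmem]
      exact zero_le
  · rw [Set.indicator_of_notMem (by simp [hmm]), add_zero, ← ENNReal.ofReal_mul hα0.le,
      ← ENNReal.ofReal_mul hε.le, ← ENNReal.ofReal_mul (by positivity),
      ← ENNReal.ofReal_mul (by linarith)]
    -- Truncating the two terms separately can only enlarge their sum, so the untruncated inequality
    -- suffices.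
    refine le_trans (ENNReal.ofReal_le_ofReal ?_) ENNReal.ofReal_add_le
    have e : ε * (α * (α * m - m₀ ^ 2 / (α * m))) +
        (1 - ε) * (α / M * (α / M * m - m₀ ^ 2 / (α / M * m))) =
        (ε * α ^ 2 + (1 - ε) * (α ^ 2 / M ^ 2)) * m - m₀ ^ 2 / m := by
      field_simp; ring
    rw [e]
    nlinarith

/-- The weighted integral of tail masses with weight `m - m₀² / m`. -/
noncomputable def tailPotential (m₀ : ℝ) (τ : ℝ → ℝ≥0∞) : ℝ≥0∞ :=
  ∫⁻ m in Set.Ioi 0, ENNReal.ofReal (m - m₀ ^ 2 / m) * τ m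

/-- The pointwise weight inequality integrated against `τ`; the added constant is gain, times
interval length, times the lower bound `q` for `τ` on that interval. -/
theorem tailPotential_step {α M ε m₀ : ℝ} (hα : 1 < α) (hM : 0 < M) (hε : 0 < ε) (hε1 : ε ≤ 1)
    (hρ : 1 ≤ ε * α ^ 2 + (1 - ε) * (α ^ 2 / M ^ 2)) (hm₀ : 0 < m₀) {τ τ' : ℝ → ℝ≥0∞}
    (hτ : Antitone τ) {q : ℝ≥0∞} (hq : q ≤ τ m₀)
    (hstep : ∀ m, 0 < m → ENNReal.ofReal ε * τ (m / α) +
      ENNReal.ofReal (1 - ε) * τ (M * (m / α)) ≤ τ' m) :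
    tailPotential m₀ τ + ENNReal.ofReal (ε * (m₀ * (((α + 1) / 2) ^ 2 - 1))) *
      ENNReal.ofReal (m₀ - m₀ * (1 + 1 / α) / 2) * q ≤ tailPotential m₀ τ' := by
  have hα0 : 0 < α := by linarith
  have hτm : Measurable τ := hτ.measurable
  set φ : ℝ → ℝ≥0∞ := fun m => ENNReal.ofReal (m - m₀ ^ 2 / m) with hφ
  have hφm : Measurable φ := by
    refine ENNReal.measurable_ofReal.comp ?_
    exact measurable_id.sub (measurable_const.div measurable_id)
  set κ := ENNReal.ofReal (ε * (m₀ * (((α + 1) / 2) ^ 2 - 1)))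
  set I := Set.Ioc (m₀ * (1 + 1 / α) / 2) m₀ with hI
  have hI0 : I ⊆ Set.Ioi 0 := fun m hm => lt_of_le_of_lt (by positivity) hm.1
  have hgap : κ * ENNReal.ofReal (m₀ - m₀ * (1 + 1 / α) / 2) * q ≤
      ∫⁻ m in Set.Ioi 0, I.indicator (fun _ => κ) m * τ m := by
    calc κ * ENNReal.ofReal (m₀ - m₀ * (1 + 1 / α) / 2) * q
        = ∫⁻ m in I, κ * q := by
          rw [lintegral_const, Measure.restrict_apply MeasurableSet.univ, Set.univ_inter, hI,
            Real.volume_Ioc]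
          ring
      _ ≤ ∫⁻ m in I, I.indicator (fun _ => κ) m * τ m := by
          refine setLIntegral_mono' measurableSet_Ioc fun m hm => ?_
          rw [Set.indicator_of_mem hm]
          gcongr
          exact hq.trans (hτ hm.2)
      _ ≤ _ := lintegral_mono_set hI0
  have e1 := lintegral_Ioi_mul_comp_div hα0 hφm hτm
  have e2 := lintegral_Ioi_mul_comp_div (div_pos hα0 hM) hφm hτm
  have hs1 : Measurable fun m => φ m * τ (m / α) :=
    hφm.mul (hτm.comp (measurable_id.div_const _))
  have hs2 : Measurable fun m => φ m * τ (m / (α / M)) :=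
    hφm.mul (hτm.comp (measurable_id.div_const _))
  have hs3 : Measurable fun m => ENNReal.ofReal α * φ (α * m) * τ m :=
    ((hφm.comp (measurable_const_mul α)).const_mul _).mul hτm
  have hs4 : Measurable fun m => ENNReal.ofReal (α / M) * φ (α / M * m) * τ m :=
    ((hφm.comp (measurable_const_mul _)).const_mul _).mul hτm
  calc tailPotential m₀ τ + κ * ENNReal.ofReal (m₀ - m₀ * (1 + 1 / α) / 2) * q
      ≤ (∫⁻ m in Set.Ioi 0, φ m * τ m) +
          ∫⁻ m in Set.Ioi 0, I.indicator (fun _ => κ) m * τ m := add_le_add le_rfl hgap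
    _ = ∫⁻ m in Set.Ioi 0, (φ m * τ m + I.indicator (fun _ => κ) m * τ m) :=
        (lintegral_add_left (f := fun m => φ m * τ m) (hφm.mul hτm) _).symm
    _ ≤ ∫⁻ m in Set.Ioi 0, (ENNReal.ofReal ε * (ENNReal.ofReal α * φ (α * m) * τ m) +
          ENNReal.ofReal (1 - ε) * (ENNReal.ofReal (α / M) * φ (α / M * m) * τ m)) := by
        refine setLIntegral_mono' measurableSet_Ioi fun m hm => ?_
        rw [← add_mul, ← mul_assoc, ← mul_assoc _ _ (τ m), ← add_mul]
        exact mul_le_mul' (harmonicWeight_step hα hM hε hε1 hρ hm₀ hm) le_rfl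
    _ = ∫⁻ m in Set.Ioi 0, (ENNReal.ofReal ε * (φ m * τ (m / α)) +
          ENNReal.ofReal (1 - ε) * (φ m * τ (m / (α / M)))) := by
        rw [lintegral_add_left (hs3.const_mul _), lintegral_const_mul _ hs3,
          lintegral_const_mul _ hs4, lintegral_add_left (hs1.const_mul _),
          lintegral_const_mul _ hs1, lintegral_const_mul _ hs2, e1, e2]
    _ ≤ tailPotential m₀ τ' := by
        refine setLIntegral_mono' measurableSet_Ioi fun m hm => ?_
        have h1 : m / (α / M) = M * (m / α) := by field_simp
        rw [h1]
        calc _ = φ m * (ENNReal.ofReal ε * τ (m / α) +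
              ENNReal.ofReal (1 - ε) * τ (M * (m / α))) := by ring
          _ ≤ _ := by gcongr; exact hstep m hm

theorem tailPotential_le (m₀ : ℝ) (τ : ℝ → ℝ≥0∞) :
    tailPotential m₀ τ ≤ ∫⁻ m in Set.Ioi 0, ENNReal.ofReal m * τ m := by
  refine setLIntegral_mono' measurableSet_Ioi fun m hm => ?_
  have : 0 ≤ m₀ ^ 2 / m := div_nonneg (sq_nonneg _) (Set.mem_Ioi.1 hm).le
  gcongr
  linarith

/-- Layer-cake formula for `2 |X|`; the halving reflects that a symmetric interval of length `m` has
radius `m / 2`. -/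
theorem lintegral_Ioi_mul_measure_abs {Ω : Type*} [MeasurableSpace Ω] (P : Measure Ω) {X : Ω → ℝ}
    (hX : Measurable X) :
    ∫⁻ m in Set.Ioi 0, ENNReal.ofReal m * P {ω | m / 2 < |X ω|} =
      2 * ∫⁻ ω, ENNReal.ofReal (X ω ^ 2) ∂P := by
  have h := lintegral_rpow_eq_lintegral_meas_lt_mul P (f := fun ω => 2 * |X ω|)
    (Eventually.of_forall fun ω => by positivity) (by fun_prop) (p := 2) (by norm_num)
  have e1 : ∀ ω, ENNReal.ofReal ((2 * |X ω|) ^ (2 : ℝ)) = 4 * ENNReal.ofReal (X ω ^ 2) := by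
    intro ω
    rw [Real.rpow_two, mul_pow, sq_abs, ENNReal.ofReal_mul (by norm_num)]
    norm_num
  have e2 : ∀ t : ℝ, P {ω | t < 2 * |X ω|} * ENNReal.ofReal (t ^ ((2 : ℝ) - 1)) =
      ENNReal.ofReal t * P {ω | t / 2 < |X ω|} := by
    intro t
    have : ((2 : ℝ) - 1) = 1 := by norm_num
    rw [this, Real.rpow_one, mul_comm]
    congr 2
    ext ω
    simp only [Set.mem_ofPred_eq]
    rw [div_lt_iff₀ (by norm_num), mul_comm]
  simp only [e1, e2] at h
  rw [lintegral_const_mul _ (by fun_prop)] at h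
  have h4 : (4 : ℝ≥0∞) = 2 * 2 := by norm_num
  rw [h4, mul_assoc, ENNReal.ofReal_ofNat] at h
  exact ((ENNReal.mul_right_inj (by norm_num) (by norm_num)).1 h).symm

/-! ### Necessity -/

section Necessity

variable {n : ℕ+} {M : ℕ} (a b : ℝ) (cb : Codebook n M) (π : Policy n M) (x₀ : ℝ)
  (μw : Measure ℝ) (ε : unitInterval)

/-- The law of the state at time `t` on the event that `h` is what the actuator has received from
the first `k` blocks. -/
noncomputable def receivedLaw (k t : ℕ) (h : Fin k → Option (Fin M)) : Measure ℝ :=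
  ((noiseLaw μw ε).restrict {ω | received a b cb π x₀ ω.1 ω.2 k = h}).map
    fun ω => state a b cb π x₀ ω.1 ω.2 t

theorem receivedLaw_apply (k t : ℕ) (h : Fin k → Option (Fin M)) {B : Set ℝ}
    (hB : MeasurableSet B) :
    receivedLaw a b cb π x₀ μw ε k t h B = noiseLaw μw ε
      {ω | state a b cb π x₀ ω.1 ω.2 t ∈ B ∧ received a b cb π x₀ ω.1 ω.2 k = h} := by
  rw [receivedLaw, Measure.map_apply (measurable_state a b cb π x₀ t) hB,
    Measure.restrict_apply (measurable_state a b cb π x₀ t hB)]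
  rfl

instance [IsProbabilityMeasure μw] (k t : ℕ) (h : Fin k → Option (Fin M)) :
    IsFiniteMeasure (receivedLaw a b cb π x₀ μw ε k t h) := by
  unfold receivedLaw; infer_instance

theorem sum_receivedLaw_apply (k t : ℕ) {B : Set ℝ} (hB : MeasurableSet B) :
    ∑ h, receivedLaw a b cb π x₀ μw ε k t h B =
      noiseLaw μw ε {ω | state a b cb π x₀ ω.1 ω.2 t ∈ B} := by
  have hm := measurable_state a b cb π x₀ t hB
  have e : {ω : (ℕ → ℝ) × (ℕ → Bool) | state a b cb π x₀ ω.1 ω.2 t ∈ B} =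
      ⋃ h, {ω | state a b cb π x₀ ω.1 ω.2 t ∈ B ∧ received a b cb π x₀ ω.1 ω.2 k = h} := by
    ext ω; simp
  rw [e, measure_iUnion]
  · rw [tsum_fintype]
    exact Finset.sum_congr rfl fun h _ => receivedLaw_apply a b cb π x₀ μw ε k t h hB
  · intro h h' hne
    refine Set.disjoint_left.2 fun ω h1 h2 => hne (h1.2.symm.trans h2.2)
  · exact fun h => hm.inter (measurableSet_received a b cb π x₀ h)

/-- `htk` makes the action at time `t` a constant on the event `h`, and `hkt` makes this event
independent of `w t`. Since `k` may exceed `t / n`, one can condition on a block whose transmission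
is still under way. -/
theorem receivedLaw_succ_apply [IsProbabilityMeasure μw] {k t : ℕ} (htk : t / n ≤ k)
    (hkt : k * n ≤ t + n)
    (h : Fin k → Option (Fin M)) {B : Set ℝ} (hB : MeasurableSet B) :
    receivedLaw a b cb π x₀ μw ε k (t + 1) h B =
      (receivedLaw a b cb π x₀ μw ε k t h).prod μw {p : ℝ × ℝ |
        a * p.1 + b * control cb π t (fun j => h (Fin.castLE htk j)) + p.2 ∈ B} := by
  set c := b * control cb π t (fun j => h (Fin.castLE htk j)) with hc
  have hS := measurableSet_affineNoise (a := a) (c := c) hB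
  have hR := measurableSet_received a b cb π x₀ h
  have hE : MeasurableSet {ω : (ℕ → ℝ) × (ℕ → Bool) | state a b cb π x₀ ω.1 ω.2 (t + 1) ∈ B ∧
      received a b cb π x₀ ω.1 ω.2 k = h} := (measurable_state a b cb π x₀ (t + 1) hB).inter hR
  rw [receivedLaw_apply _ _ _ _ _ _ _ _ _ _ hB, Measure.prod_apply hS, receivedLaw,
    lintegral_map (measurable_measure_prodMk_left hS) (measurable_state a b cb π x₀ t),
    ← lintegral_indicator hR, ← lintegral_indicator_one hE,
    lintegral_noiseLaw_update_fst μw ε t (measurable_one.indicator hE)]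
  refine lintegral_congr fun ω => ?_
  have hrec : ∀ v, received a b cb π x₀ (Function.update ω.1 t v) ω.2 k =
      received a b cb π x₀ ω.1 ω.2 k := fun v =>
    received_congr (fun i hi => Function.update_of_ne (by omega) _ _) fun _ _ => rfl
  have hst : ∀ v, state a b cb π x₀ (Function.update ω.1 t v) ω.2 t =
      state a b cb π x₀ ω.1 ω.2 t := fun v =>
    state_congr (fun i hi => Function.update_of_ne (by omega) _ _) fun _ _ => rfl
  by_cases hω : received a b cb π x₀ ω.1 ω.2 k = h
  · rw [Set.indicator_of_mem (show ω ∈ {ω | received a b cb π x₀ ω.1 ω.2 k = h} from hω),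
      ← lintegral_indicator_one (measurable_prodMk_left hS)]
    refine lintegral_congr fun v => ?_
    have hact : b * action a b cb π x₀ (Function.update ω.1 t v) ω.2 t = c := by
      rw [hc, action_eq]
      congr 2
      funext j
      rw [← hω, ← hrec v]
      rfl
    have hmem : (Function.update ω.1 t v, ω.2) ∈ {ω : (ℕ → ℝ) × (ℕ → Bool) |
        state a b cb π x₀ ω.1 ω.2 (t + 1) ∈ B ∧ received a b cb π x₀ ω.1 ω.2 k = h} ↔
        v ∈ Prod.mk (state a b cb π x₀ ω.1 ω.2 t) ⁻¹' {p : ℝ × ℝ | a * p.1 + c + p.2 ∈ B} := by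
      simp only [Set.mem_ofPred_eq, Set.mem_preimage, hrec, hω, and_true, state_succ, hact, hst,
        Function.update_self]
    by_cases hv : v ∈ Prod.mk (state a b cb π x₀ ω.1 ω.2 t) ⁻¹'
        {p : ℝ × ℝ | a * p.1 + c + p.2 ∈ B}
    · rw [Set.indicator_of_mem hv, Set.indicator_of_mem (hmem.2 hv)]; rfl
    · rw [Set.indicator_of_notMem hv, Set.indicator_of_notMem (mt hmem.1 hv)]
  · rw [Set.indicator_of_notMem (show ω ∉ {ω | received a b cb π x₀ ω.1 ω.2 k = h} from hω)]
    refine (lintegral_congr fun v => ?_).trans lintegral_zero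
    refine Set.indicator_of_notMem (fun hmem => hω ?_) _
    rw [← hrec v]
    exact hmem.2

theorem noiseLaw_apply_update_snd (k : ℕ) {E : Set ((ℕ → ℝ) × (ℕ → Bool))}
    (hE : MeasurableSet E) {E₀ E₁ : Set ((ℕ → ℝ) × (ℕ → Bool))}
    (h₀ : MeasurableSet E₀) (h₁ : MeasurableSet E₁)
    (he₀ : ∀ ω, (ω.1, Function.update ω.2 k false) ∈ E ↔ ω ∈ E₀)
    (he₁ : ∀ ω, (ω.1, Function.update ω.2 k true) ∈ E ↔ ω ∈ E₁) :
    noiseLaw μw ε E = ENNReal.ofReal ε * noiseLaw μw ε E₀ +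
      ENNReal.ofReal (1 - ε) * noiseLaw μw ε E₁ := by
  rw [← lintegral_indicator_one hE, lintegral_noiseLaw_update_snd μw ε k
    (measurable_one.indicator hE), ← lintegral_indicator_one h₀, ← lintegral_indicator_one h₁,
    ← lintegral_const_mul _ (measurable_one.indicator h₀),
    ← lintegral_const_mul _ (measurable_one.indicator h₁),
    ← lintegral_add_left ((measurable_one.indicator h₀).const_mul _)]
  refine lintegral_congr fun ω => ?_
  congr 2
  · by_cases hω : ω ∈ E₀
    · rw [Set.indicator_of_mem hω, Set.indicator_of_mem ((he₀ ω).2 hω)]; rfl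
    · rw [Set.indicator_of_notMem hω, Set.indicator_of_notMem (mt (he₀ ω).1 hω)]
  · by_cases hω : ω ∈ E₁
    · rw [Set.indicator_of_mem hω, Set.indicator_of_mem ((he₁ ω).2 hω)]; rfl
    · rw [Set.indicator_of_notMem hω, Set.indicator_of_notMem (mt (he₁ ω).1 hω)]

/-- The law of the state at time `k n` on the event that `h` is what the actuator has received and
that the next codeword is the one with index `i`. -/
noncomputable def messageLaw (k : ℕ) (h : Fin k → Option (Fin M)) (i : Fin M) : Measure ℝ :=
  ((noiseLaw μw ε).restrict {ω | received a b cb π x₀ ω.1 ω.2 k = h ∧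
    message a b cb π x₀ ω.1 ω.2 k = i}).map fun ω => state a b cb π x₀ ω.1 ω.2 (k * n)

theorem measurableSet_received_message (k : ℕ) (h : Fin k → Option (Fin M)) (i : Fin M) :
    MeasurableSet {ω : (ℕ → ℝ) × (ℕ → Bool) | received a b cb π x₀ ω.1 ω.2 k = h ∧
      message a b cb π x₀ ω.1 ω.2 k = i} :=
  (measurableSet_received a b cb π x₀ h).inter
    (measurable_message a b cb π x₀ k (MeasurableSet.of_discrete (s := {i})))

theorem sum_messageLaw (k : ℕ) (h : Fin k → Option (Fin M)) :
    ∑ i, messageLaw a b cb π x₀ μw ε k h i = receivedLaw a b cb π x₀ μw ε k (k * n) h := by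
  ext B hB
  have hm := measurable_state a b cb π x₀ (k * n) hB
  have e : {ω : (ℕ → ℝ) × (ℕ → Bool) | state a b cb π x₀ ω.1 ω.2 (k * n) ∈ B ∧
      received a b cb π x₀ ω.1 ω.2 k = h} =
      ⋃ i, {ω | state a b cb π x₀ ω.1 ω.2 (k * n) ∈ B ∧ (received a b cb π x₀ ω.1 ω.2 k = h ∧
        message a b cb π x₀ ω.1 ω.2 k = i)} := by
    ext ω; simp
  rw [receivedLaw_apply _ _ _ _ _ _ _ _ _ _ hB, e, measure_iUnion, tsum_fintype,
    Measure.finsetSum_apply]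
  · refine Finset.sum_congr rfl fun i _ => ?_
    rw [messageLaw, Measure.map_apply (measurable_state a b cb π x₀ _) hB,
      Measure.restrict_apply hm]
    rfl
  · intro i i' hne
    refine Set.disjoint_left.2 fun ω h1 h2 => hne (h1.2.2.symm.trans h2.2.2)
  · exact fun i => hm.inter (measurableSet_received_message a b cb π x₀ k h i)

theorem received_succ (w : ℕ → ℝ) (s : ℕ → Bool) (k : ℕ) :
    received a b cb π x₀ w s (k + 1) = Fin.snoc (received a b cb π x₀ w s k)
      (if s k then some (message a b cb π x₀ w s k) else none) := by
  funext j
  refine Fin.lastCases ?_ (fun i => ?_) j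
  · simp [received]
  · simp [received]

theorem received_succ_eq_snoc_iff (w : ℕ → ℝ) (s : ℕ → Bool) (k : ℕ)
    (h : Fin k → Option (Fin M)) (o : Option (Fin M)) :
    received a b cb π x₀ w s (k + 1) = Fin.snoc h o ↔ received a b cb π x₀ w s k = h ∧
      (if s k then some (message a b cb π x₀ w s k) else none) = o := by
  rw [received_succ]
  constructor
  · intro e
    have e' := Fin.snoc_inj.1 e
    exact e'
  · rintro ⟨rfl, rfl⟩; rfl

theorem received_update (w : ℕ → ℝ) (s : ℕ → Bool) (k : ℕ) (v : Bool) :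
    received a b cb π x₀ w (Function.update s k v) k = received a b cb π x₀ w s k :=
  received_congr (fun _ _ => rfl) fun _ hj => Function.update_of_ne hj.ne _ _

theorem state_update (w : ℕ → ℝ) (s : ℕ → Bool) (k : ℕ) (v : Bool) :
    state a b cb π x₀ w (Function.update s k v) (k * n) = state a b cb π x₀ w s (k * n) :=
  state_congr (fun _ _ => rfl) fun _ hj =>
    Function.update_of_ne (Nat.lt_of_mul_lt_mul_right hj).ne _ _

theorem message_update (w : ℕ → ℝ) (s : ℕ → Bool) (k : ℕ) (v : Bool) :
    message a b cb π x₀ w (Function.update s k v) k = message a b cb π x₀ w s k :=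
  message_congr (fun _ _ => rfl) fun _ hj => Function.update_of_ne hj.ne _ _

theorem receivedLaw_snoc_none (k : ℕ) (h : Fin k → Option (Fin M)) :
    receivedLaw a b cb π x₀ μw ε (k + 1) (k * n) (Fin.snoc h none) =
      ENNReal.ofReal ε • receivedLaw a b cb π x₀ μw ε k (k * n) h := by
  ext B hB
  have hm := measurable_state a b cb π x₀ (k * n) hB
  rw [Measure.smul_apply, receivedLaw_apply _ _ _ _ _ _ _ _ _ _ hB,
    receivedLaw_apply _ _ _ _ _ _ _ _ _ _ hB]
  refine (noiseLaw_apply_update_snd μw ε k (hm.inter (measurableSet_received a b cb π x₀ _))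
      (hm.inter (measurableSet_received a b cb π x₀ h)) MeasurableSet.empty
      (fun ω => by simp [received_succ_eq_snoc_iff, received_update, state_update])
      (fun ω => by simp [received_succ_eq_snoc_iff, received_update, state_update])).trans ?_
  rw [measure_empty, mul_zero, add_zero]
  rfl

theorem receivedLaw_snoc_some (k : ℕ) (h : Fin k → Option (Fin M)) (i : Fin M) :
    receivedLaw a b cb π x₀ μw ε (k + 1) (k * n) (Fin.snoc h (some i)) =
      ENNReal.ofReal (1 - ε) • messageLaw a b cb π x₀ μw ε k h i := by
  ext B hB
  have hm := measurable_state a b cb π x₀ (k * n) hB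
  rw [Measure.smul_apply, receivedLaw_apply _ _ _ _ _ _ _ _ _ _ hB, messageLaw,
    Measure.map_apply (measurable_state a b cb π x₀ _) hB, Measure.restrict_apply hm]
  refine (noiseLaw_apply_update_snd μw ε k (hm.inter (measurableSet_received a b cb π x₀ _))
      MeasurableSet.empty (hm.inter (measurableSet_received_message a b cb π x₀ k h i))
      (fun ω => by simp [received_succ_eq_snoc_iff, received_update, state_update])
      (fun ω => by
        simp [received_succ_eq_snoc_iff, received_update, state_update, message_update])).trans ?_
  rw [measure_empty, mul_zero, zero_add]
  rfl

/-- The tail masses of the state at time `t`, summed over what the actuator can have received from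
the first `k` blocks. -/
noncomputable def receivedTail (k t : ℕ) (m : ℝ) : ℝ≥0∞ :=
  ∑ h, tailMass (receivedLaw a b cb π x₀ μw ε k t h) m

theorem antitone_receivedTail (k t : ℕ) : Antitone (receivedTail a b cb π x₀ μw ε k t) :=
  fun _ _ h => Finset.sum_le_sum fun _ _ => antitone_tailMass _ h

theorem receivedTail_le (k t : ℕ) (m : ℝ) : receivedTail a b cb π x₀ μw ε k t m ≤
    noiseLaw μw ε {ω | m / 2 < |state a b cb π x₀ ω.1 ω.2 t|} := by
  have hB : MeasurableSet {x : ℝ | m / 2 < |x|} :=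
    measurableSet_lt measurable_const measurable_id.abs
  exact (Finset.sum_le_sum fun h _ => tailMass_le_measure_abs _ m).trans
    (sum_receivedLaw_apply a b cb π x₀ μw ε k t hB).le

theorem receivedTail_div_le [IsProbabilityMeasure μw] {k t : ℕ} (ha : a ≠ 0) (htk : t / n ≤ k)
    (hkt : k * n ≤ t + n) (m : ℝ) :
    receivedTail a b cb π x₀ μw ε k t (m / |a|) ≤ receivedTail a b cb π x₀ μw ε k (t + 1) m :=
  Finset.sum_le_sum fun h _ => tailMass_div_le_of_affineNoise ha fun _ hB =>
    receivedLaw_succ_apply a b cb π x₀ μw ε htk hkt h hB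

theorem tailMass_le_receivedTail [IsProbabilityMeasure μw] {k t : ℕ} (htk : t / n ≤ k)
    (hkt : k * n ≤ t + n) (m : ℝ) :
    tailMass μw m ≤ receivedTail a b cb π x₀ μw ε k (t + 1) m := by
  have h1 := sum_receivedLaw_apply a b cb π x₀ μw ε k t MeasurableSet.univ
  simp only [Set.mem_univ, Set.ofPred_true, measure_univ] at h1
  calc tailMass μw m = ∑ h, receivedLaw a b cb π x₀ μw ε k t h Set.univ * tailMass μw m := by
        rw [← Finset.sum_mul, h1, one_mul]
    _ ≤ _ := Finset.sum_le_sum fun h _ => measure_univ_mul_tailMass_le_of_affineNoise fun _ hB =>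
        receivedLaw_succ_apply a b cb π x₀ μw ε htk hkt h hB

theorem receivedTail_pow_le [IsProbabilityMeasure μw] (ha : a ≠ 0) (k : ℕ) {j : ℕ}
    (hj : j ≤ n) (m : ℝ) :
    receivedTail a b cb π x₀ μw ε (k + 1) (k * n) (m / |a| ^ j) ≤
      receivedTail a b cb π x₀ μw ε (k + 1) (k * n + j) m := by
  induction j generalizing m with
  | zero => simp
  | succ j ih =>
    have h1 : (k * n + j) / n ≤ k + 1 := by
      rw [Nat.div_le_iff_le_mul_add_pred n.pos]
      nlinarith
    have h2 : (k + 1) * n ≤ k * n + j + n := by rw [Nat.succ_mul]; omega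
    refine le_trans ?_ (receivedTail_div_le a b cb π x₀ μw ε ha h1 h2 m)
    rw [pow_succ', ← div_div]
    exact ih (by omega) _

/-- The state at time `k n` is independent of the outcome of block `k`. An erasure leaves each
conditional law intact up to the factor `ε`; a success splits it by message, and `tailMass_sum_le`
applies. -/
theorem receivedTail_erasure (k : ℕ) (m : ℝ) :
    ENNReal.ofReal ε * receivedTail a b cb π x₀ μw ε k (k * n) m +
      ENNReal.ofReal (1 - ε) * receivedTail a b cb π x₀ μw ε k (k * n) (M * m) ≤
      receivedTail a b cb π x₀ μw ε (k + 1) (k * n) m := by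
  have hsum : receivedTail a b cb π x₀ μw ε (k + 1) (k * n) m =
      ∑ h : Fin k → Option (Fin M), (tailMass (receivedLaw a b cb π x₀ μw ε (k + 1) (k * n)
          (Fin.snoc h none)) m +
        ∑ i, tailMass (receivedLaw a b cb π x₀ μw ε (k + 1) (k * n) (Fin.snoc h (some i))) m) := by
    rw [receivedTail, ← (Fin.snocEquiv fun _ => Option (Fin M)).sum_comp,
      Fintype.sum_prod_type_right]
    refine Finset.sum_congr rfl fun h _ => ?_
    rw [Fintype.sum_option]
    rfl
  rw [hsum, receivedTail, receivedTail, Finset.mul_sum, Finset.mul_sum, ← Finset.sum_add_distrib]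
  refine Finset.sum_le_sum fun h _ => ?_
  rw [receivedLaw_snoc_none]
  refine add_le_add (mul_tailMass_le _ _ _) ?_
  have h1 := tailMass_sum_le (messageLaw a b cb π x₀ μw ε k h) m
  rw [sum_messageLaw, Fintype.card_fin] at h1
  calc _ ≤ ENNReal.ofReal (1 - ε) * ∑ i, tailMass (messageLaw a b cb π x₀ μw ε k h i) m := by
        gcongr
    _ ≤ _ := by
        rw [Finset.mul_sum]
        refine Finset.sum_le_sum fun i _ => ?_
        rw [receivedLaw_snoc_some]
        exact mul_tailMass_le _ _ _

theorem averageCost_eq_top [IsProbabilityMeasure μw] (ha : 1 < |a|) (hμw : μw ≪ volume)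
    (hε : 0 < (ε : ℝ)) (hM : 0 < M)
    (hρ : 1 ≤ (ε : ℝ) * a ^ (2 * (n : ℕ)) + (1 - ε) * (a ^ (2 * (n : ℕ)) / (M : ℝ) ^ 2)) :
    averageCost a b μw ε cb π x₀ = ⊤ := by
  obtain ⟨m₀, hm₀, hq⟩ := exists_tailMass_pos hμw
  have ha0 : a ≠ 0 := by rintro rfl; norm_num at ha
  have hα : 1 < |a| ^ (n : ℕ) := one_lt_pow₀ ha n.pos.ne'
  have hα2 : a ^ (2 * (n : ℕ)) = (|a| ^ (n : ℕ)) ^ 2 := by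
    rw [← pow_mul, mul_comm (n : ℕ) 2, pow_mul |a|, sq_abs, pow_mul]
  rw [hα2] at hρ
  set α := |a| ^ (n : ℕ) with hαdef
  set g := ENNReal.ofReal (ε * (m₀ * (((α + 1) / 2) ^ 2 - 1))) *
      ENNReal.ofReal (m₀ - m₀ * (1 + 1 / α) / 2) * tailMass μw m₀ with hg
  have hg0 : g ≠ 0 := by
    have h1 : 1 / α < 1 := by rw [div_lt_one (by linarith)]; exact hα
    refine mul_ne_zero (mul_ne_zero ?_ ?_) hq.ne'
    · exact (ENNReal.ofReal_pos.2 (mul_pos hε (mul_pos hm₀ (by nlinarith)))).ne'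
    · exact (ENNReal.ofReal_pos.2 (by nlinarith)).ne'
  let τ : ℕ → ℝ → ℝ≥0∞ := fun k => receivedTail a b cb π x₀ μw ε k (k * n)
  -- The last disturbance before time `(k + 1) n` provides this. It fails to give anything at time
  -- zero, where the state is deterministic, so the growth below is counted from the first block on.
  have hlow : ∀ k, tailMass μw m₀ ≤ τ (k + 1) m₀ := by
    intro k
    have hn := n.pos
    have e : (k + 1) * (n : ℕ) = (k * n + (n - 1)) + 1 := by rw [Nat.succ_mul]; omega
    show _ ≤ receivedTail a b cb π x₀ μw ε (k + 1) ((k + 1) * n) m₀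
    rw [e]
    refine tailMass_le_receivedTail a b cb π x₀ μw ε ?_ (by omega) m₀
    rw [Nat.div_le_iff_le_mul_add_pred n.pos]
    nlinarith
  have hstep : ∀ k m, ENNReal.ofReal ε * τ k (m / α) +
      ENNReal.ofReal (1 - ε) * τ k (M * (m / α)) ≤ τ (k + 1) m := by
    intro k m
    refine (receivedTail_erasure a b cb π x₀ μw ε k (m / α)).trans ?_
    have := receivedTail_pow_le a b cb π x₀ μw ε ha0 k le_rfl m
    rwa [← Nat.succ_mul] at this
  have hgrow : ∀ k : ℕ, (k : ℝ≥0∞) * g ≤ tailPotential m₀ (τ (k + 1)) := by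
    intro k
    induction k with
    | zero => simp
    | succ k ih =>
      have := tailPotential_step hα (Nat.cast_pos.2 hM) hε ε.2.2 hρ hm₀
        (antitone_receivedTail a b cb π x₀ μw ε (k + 1) ((k + 1) * n)) (hlow k)
        (fun m _ => hstep (k + 1) m)
      refine le_trans ?_ this
      rw [Nat.cast_succ, add_mul, one_mul]
      exact add_le_add ih le_rfl
  have hcost : ∀ k : ℕ, (k : ℝ≥0∞) * g ≤ 2 * ∫⁻ ω, ENNReal.ofReal
      (state a b cb π x₀ ω.1 ω.2 ((k + 1) * n) ^ 2) ∂(noiseLaw μw ε) := by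
    intro k
    refine ((hgrow k).trans (tailPotential_le _ _)).trans ?_
    rw [← lintegral_Ioi_mul_measure_abs _ (measurable_state a b cb π x₀ _)]
    refine lintegral_mono fun m => ?_
    gcongr
    exact receivedTail_le a b cb π x₀ μw ε _ _ m
  by_contra htop
  obtain ⟨C, hC1, hC2⟩ := exists_between (lt_top_iff_ne_top.2 htop)
  have hev := eventually_lt_of_limsup_lt hC1
  obtain ⟨T, hT⟩ := eventually_atTop.1 hev
  obtain ⟨K, hK⟩ := ENNReal.exists_nat_mul_gt hg0
    (ENNReal.mul_ne_top ENNReal.ofNat_ne_top hC2.ne : 2 * C ≠ ⊤)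
  -- One block-end time that is both late enough for the supposed bound `C` and late enough for the
  -- linear growth to exceed it.
  have hTK : T ≤ (max T K + 1) * n :=
    le_trans (by omega) (Nat.le_mul_of_pos_right (max T K + 1) n.pos)
  have h1 := (hcost (max T K)).trans (mul_le_mul_right (hT _ hTK).le 2)
  have h2 : (K : ℝ≥0∞) * g ≤ (max T K : ℕ) * g := by
    gcongr
    exact le_max_right _ _
  exact absurd (hK.trans_le (h2.trans h1)) (lt_irrefl _)

end Necessity

/-! ### Sufficiency -/

section UniformQuantizer

variable {M : ℕ} [NeZero M]

/-- The cell of `y` in the partition of `[-L, L]` into `M` intervals of equal length. -/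
noncomputable def cellIndex (M : ℕ) [NeZero M] (L y : ℝ) : Fin M :=
  Fin.ofNat M (min (M - 1) ⌊(y + L) * M / (2 * L)⌋₊)

/-- The midpoint of the `i`-th of `M` intervals of equal length that partition `[-L, L]`. -/
noncomputable def cellCenter (L : ℝ) (i : Fin M) : ℝ := -L + (2 * (i : ℕ) + 1) * L / M

theorem measurable_cellIndex (L : ℝ) : Measurable (cellIndex M L) := by
  have h : Measurable fun y : ℝ => ⌊(y + L) * M / (2 * L)⌋₊ :=
    Nat.measurable_floor.comp (by fun_prop)
  exact (Measurable.of_discrete (f := fun j : ℕ => Fin.ofNat M (min (M - 1) j))).comp h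

theorem abs_sub_cellCenter_le {L y : ℝ} (hL : 0 < L) (hy : |y| ≤ L) :
    |y - cellCenter L (cellIndex M L y)| ≤ L / M := by
  have hM : 0 < M := NeZero.pos M
  have hMR : (0 : ℝ) < M := Nat.cast_pos.2 hM
  obtain ⟨hy1, hy2⟩ := abs_le.1 hy
  set z := (y + L) * M / (2 * L) with hz
  have hz0 : 0 ≤ z := div_nonneg (mul_nonneg (by linarith) hMR.le) (by linarith)
  have hzM : z ≤ M := by
    rw [hz, div_le_iff₀ (by linarith)]; nlinarith
  have hval : ((cellIndex M L y : Fin M) : ℕ) = min (M - 1) ⌊z⌋₊ := by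
    simp only [cellIndex, Fin.ofNat]
    exact Nat.mod_eq_of_lt (by omega)
  set j := min (M - 1) ⌊z⌋₊ with hj
  have h1 : (j : ℝ) ≤ z :=
    (Nat.cast_le.2 (min_le_right _ _)).trans (Nat.floor_le hz0)
  -- Clipping at `M - 1` matters at `y = L`, where the floor is `M`.
  have h2 : z ≤ j + 1 := by
    rcases le_total (M - 1) ⌊z⌋₊ with h | h
    · rw [hj, min_eq_left h]
      have : ((M - 1 : ℕ) : ℝ) + 1 = M := by
        rw [← Nat.cast_succ]; congr 1; omega
      linarith
    · rw [hj, min_eq_right h]; exact (Nat.lt_floor_add_one z).le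
  have e : y - cellCenter L (cellIndex M L y) = L / M * (2 * z - 2 * j - 1) := by
    rw [cellCenter, hval, hz]; field_simp; ring
  rw [e, abs_mul, abs_of_pos (div_pos hL hMR)]
  refine mul_le_of_le_one_right (div_pos hL hMR).le (abs_le.2 ⟨by linarith, by linarith⟩)

end UniformQuantizer

/-- A family over `Fin k`, continued by a default value. -/
def extendFin {β : Type*} (d : β) {k : ℕ} (f : Fin k → β) (j : ℕ) : β :=
  if h : j < k then f ⟨j, h⟩ else d

theorem extendFin_of_lt {β : Type*} (d : β) {k : ℕ} (f : Fin k → β) {j : ℕ} (h : j < k) :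
    extendFin d f j = f ⟨j, h⟩ := dif_pos h

-- Open-loop evolution within a block

section BetweenControls

variable {a b : ℝ} {n : ℕ+} {M : ℕ} (cb : Codebook n M) (x₀ : ℝ) (w : ℕ → ℝ) (s : ℕ → Bool)
  (π : Policy n M)

theorem action_eq_zero_of_not_dvd {t : ℕ} (h : ¬(n : ℕ) ∣ t) :
    action a b cb π x₀ w s t = 0 := by
  rw [action, if_neg fun hc => h hc.2]

/-- After the control at time `k n` the input is zero until the next block, so the deviation is the
accumulated noise, a geometric sum. -/
theorem abs_state_sub_le {W : ℝ} (hw : ∀ i, |w i| ≤ W) (k : ℕ) {j : ℕ}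
    (hj : j < n) :
    |state a b cb π x₀ w s (k * n + j + 1) - a ^ j *
      (a * state a b cb π x₀ w s (k * n) + b * action a b cb π x₀ w s (k * n))| ≤
      W * ∑ i ∈ Finset.range (j + 1), |a| ^ i := by
  induction j with
  | zero => simpa [state_succ] using hw (k * n)
  | succ j ih =>
    have hnd : ¬(n : ℕ) ∣ k * n + (j + 1) := fun hd =>
      (Nat.le_of_dvd j.succ_pos ((Nat.dvd_add_right (dvd_mul_left _ _)).1 hd)).not_gt hj
    rw [state_succ, action_eq_zero_of_not_dvd cb x₀ w s π hnd, ← add_assoc,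
      Finset.sum_range_succ', mul_add W, Finset.sum_congr rfl fun i _ => pow_succ' |a| i,
      ← Finset.mul_sum]
    have := ih (by omega)
    set S := state a b cb π x₀ w s (k * n + j + 1)
    set V := a * state a b cb π x₀ w s (k * n) + b * action a b cb π x₀ w s (k * n)
    have e : a * S + b * 0 + w (k * n + j + 1) - a ^ (j + 1) * V =
        a * (S - a ^ j * V) + w (k * n + j + 1) := by ring
    rw [e]
    refine (abs_add_le _ _).trans (add_le_add ?_ ?_)
    · rw [abs_mul, mul_left_comm]
      gcongr
    · simpa using hw _

end BetweenControls

-- The tracking interval and its policy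

section Tracking

variable (a b D X : ℝ) (n : ℕ+) (M : ℕ)

/-- Half the length of the interval to which the state at time `k n` is known to belong. -/
noncomputable def trackRadius (s : ℕ → Bool) : ℕ → ℝ
  | 0 => X
  | k + 1 => |a| ^ (n : ℕ) * (if s k then trackRadius s k / M else trackRadius s k) + D

/-- The midpoint of the interval to which the state at time `k n` is known to belong. -/
noncomputable def trackCenter (s : ℕ → Bool) (m : ℕ → Fin M) : ℕ → ℝ
  | 0 => 0
  | k + 1 => a ^ (n : ℕ) * (if s k then cellCenter (trackRadius a D X n M s k) (m k) else 0)

variable {a b D X n M}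

theorem trackRadius_congr {s s' : ℕ → Bool} {k : ℕ} (h : ∀ j < k, s j = s' j) :
    trackRadius a D X n M s k = trackRadius a D X n M s' k := by
  induction k with
  | zero => rfl
  | succ k ih =>
    rw [trackRadius, trackRadius, ih fun j hj => h j (hj.trans k.lt_succ_self),
      h k k.lt_succ_self]

/-- Messages of erased blocks do not enter the midpoint. Hence the actuator, which fills them with
arbitrary defaults, computes the same midpoint as the encoder. -/
theorem trackCenter_congr {s s' : ℕ → Bool} {m m' : ℕ → Fin M} {k : ℕ}
    (h : ∀ j < k, s j = s' j) (hm : ∀ j < k, s j = true → m j = m' j) :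
    trackCenter a D X n M s m k = trackCenter a D X n M s' m' k := by
  cases k with
  | zero => rfl
  | succ k =>
    rw [trackCenter, trackCenter, ← h k k.lt_succ_self,
      trackRadius_congr fun j hj => h j (hj.trans k.lt_succ_self)]
    split_ifs with hs
    · rw [hm k k.lt_succ_self hs]
    · rfl

theorem trackRadius_pos (ha : a ≠ 0) (hD : 0 ≤ D) (hX : 0 < X) (hM : 0 < M) (s : ℕ → Bool)
    (k : ℕ) : 0 < trackRadius a D X n M s k := by
  induction k with
  | zero => exact hX
  | succ k ih =>
    have : (0 : ℝ) < M := Nat.cast_pos.2 hM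
    rw [trackRadius]
    split_ifs <;> positivity

theorem measurable_trackRadius (k : ℕ) : Measurable fun s => trackRadius a D X n M s k := by
  induction k with
  | zero => exact measurable_const
  | succ k ih =>
    simp only [trackRadius]
    exact ((Measurable.ite (measurable_pi_apply k (MeasurableSet.of_discrete (s := {true})))
      (ih.div_const _) ih).const_mul _).add_const _

variable (a b D X) [NeZero M] (cb : Codebook n M)

/-- The policy that quantizes the deviation of the state from the midpoint of the tracking
interval uniformly, and steers that midpoint to zero. -/
noncomputable def trackPolicy : Policy n M where
  quantizer k x c s := cellIndex M (trackRadius a D X n M (extendFin false s) k)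
    (x (Fin.last (k * n)) - trackCenter a D X n M (extendFin false s)
      (fun j => Function.invFun cb (extendFin 0 c j)) k)
  decoder k o := -(a / b) * trackCenter a D X n M (fun j => (extendFin none o j).isSome)
    (fun j => Function.invFun cb ((extendFin none o j).getD 0)) k
  measurable_quantizer _ _ _ :=
    (measurable_cellIndex _).comp ((measurable_pi_apply _).sub_const _)

variable {a b D X} (x₀ : ℝ) (w : ℕ → ℝ) (s : ℕ → Bool)

theorem message_trackPolicy (k : ℕ) :
    message a b cb (trackPolicy a b D X cb) x₀ w s k =
      cellIndex M (trackRadius a D X n M s k)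
        (state a b cb (trackPolicy a b D X cb) x₀ w s (k * n) -
          trackCenter a D X n M s (message a b cb (trackPolicy a b D X cb) x₀ w s) k) := by
  conv_lhs => rw [message]
  have hs : ∀ j < k, extendFin false (fun j : Fin k => s j) j = s j := fun j hj =>
    extendFin_of_lt _ _ hj
  simp only [trackPolicy, codeword_eq, Fin.val_last]
  rw [trackRadius_congr hs]
  congr 2
  refine trackCenter_congr hs fun j hj _ => ?_
  rw [extendFin_of_lt _ _ hj]
  exact Function.leftInverse_invFun cb.injective _

theorem action_trackPolicy (k : ℕ) :
    action a b cb (trackPolicy a b D X cb) x₀ w s (k * n) =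
      -(a / b) * trackCenter a D X n M s
        (message a b cb (trackPolicy a b D X cb) x₀ w s) k := by
  rcases Nat.eq_zero_or_pos k with rfl | hk
  -- No control is applied at time zero, consistent with the initial midpoint being zero.
  · rw [action, if_neg (by simp)]; simp [trackCenter]
  · rw [action, if_pos ⟨Nat.mul_pos hk n.pos, dvd_mul_left _ _⟩]
    have hdiv : k * (n : ℕ) / n = k := Nat.mul_div_cancel _ n.pos
    simp only [codeword_eq]
    generalize k * (n : ℕ) / n = k' at hdiv
    subst hdiv
    simp only [trackPolicy]
    congr 1
    refine trackCenter_congr (fun j hj => ?_) fun j hj hsj => ?_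
    · rw [extendFin_of_lt _ _ hj]
      cases s j <;> simp
    · rw [extendFin_of_lt _ _ hj] at hsj ⊢
      have : s j = true := by
        by_contra hc
        simp [hc] at hsj
      simp only [this, if_true, Option.getD_some]
      exact Function.leftInverse_invFun cb.injective _

/-- The control turns `a x` into `a (x - c)`. The codeword of block `k` locates `x - c` within one
cell, so after the block the state is known up to `α` times the remaining uncertainty, plus noise at
most `D`. -/
theorem abs_state_sub_trackCenter_le {W : ℝ} (ha : a ≠ 0) (hb : b ≠ 0) (hW : 0 ≤ W)
    (hw : ∀ i, |w i| ≤ W) (hX : 0 < X) (hx₀ : |x₀| ≤ X)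
    (hD : D = W * ∑ i ∈ Finset.range n, |a| ^ i) (k : ℕ) :
    |state a b cb (trackPolicy a b D X cb) x₀ w s (k * n) - trackCenter a D X n M s
        (message a b cb (trackPolicy a b D X cb) x₀ w s) k| ≤ trackRadius a D X n M s k := by
  have hD0 : 0 ≤ D := by rw [hD]; positivity
  induction k with
  | zero => simpa [state_zero, trackCenter, trackRadius] using hx₀
  | succ k ih =>
    have hn := n.pos
    have h1 := abs_state_sub_le (a := a) (b := b) cb x₀ w s (trackPolicy a b D X cb) hw k
      (j := n - 1) (by omega)
    have e1 : k * (n : ℕ) + (n - 1) + 1 = (k + 1) * n := by rw [Nat.succ_mul]; omega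
    have e2 : (n : ℕ) - 1 + 1 = n := by omega
    rw [e1, e2, ← hD, action_trackPolicy] at h1
    have hmsg := message_trackPolicy (a := a) (b := b) (D := D) (X := X) cb x₀ w s k
    have hpos := trackRadius_pos (n := n) ha hD0 hX (NeZero.pos M) s k
    rw [trackCenter, trackRadius]
    set L := trackRadius a D X n M s k
    set m := message a b cb (trackPolicy a b D X cb) x₀ w s
    set c := trackCenter a D X n M s m k
    set x := state a b cb (trackPolicy a b D X cb) x₀ w s (k * n)
    set x' := state a b cb (trackPolicy a b D X cb) x₀ w s ((k + 1) * n)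
    set q := if s k then cellCenter L (m k) else 0 with hq
    have hres : |x - c - q| ≤ if s k then L / M else L := by
      rw [hq]
      split_ifs with hsk
      · rw [hmsg]; exact abs_sub_cellCenter_le hpos ih
      · simpa using ih
    have e3 : a ^ ((n : ℕ) - 1) * (a * x + b * (-(a / b) * c)) = a ^ (n : ℕ) * (x - c) := by
      have : a ^ (n : ℕ) = a ^ ((n : ℕ) - 1) * a := by rw [← pow_succ, e2]
      rw [this]; field_simp; ring
    rw [e3] at h1
    have e4 : x' - a ^ (n : ℕ) * q =
        a ^ (n : ℕ) * (x - c - q) + (x' - a ^ (n : ℕ) * (x - c)) := by ring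
    rw [e4]
    refine (abs_add_le _ _).trans (add_le_add ?_ h1)
    rw [abs_mul, abs_pow]
    gcongr

theorem abs_state_trackPolicy_le {W : ℝ} (ha : 1 < |a|) (hb : b ≠ 0) (hW : 0 ≤ W)
    (hw : ∀ i, |w i| ≤ W) (hX : 0 < X) (hx₀ : |x₀| ≤ X)
    (hD : D = W * ∑ i ∈ Finset.range n, |a| ^ i) (t : ℕ) :
    |state a b cb (trackPolicy a b D X cb) x₀ w s (t + 1)| ≤
      |a| ^ (n : ℕ) * trackRadius a D X n M s (t / n) + D := by
  have ha0 : a ≠ 0 := by rintro rfl; norm_num at ha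
  have hj : t % n < n := Nat.mod_lt _ n.pos
  have h1 := abs_state_sub_le (a := a) (b := b) cb x₀ w s (trackPolicy a b D X cb) hw (t / n) hj
  have h2 := abs_state_sub_trackCenter_le cb x₀ w s ha0 hb hW hw hX hx₀ hD (t / n)
  rw [action_trackPolicy, Nat.div_add_mod'] at h1
  set c := trackCenter a D X n M s (message a b cb (trackPolicy a b D X cb) x₀ w s) (t / n)
  set x := state a b cb (trackPolicy a b D X cb) x₀ w s (t / n * n)
  have e3 : a ^ (t % n) * (a * x + b * (-(a / b) * c)) = a ^ (t % n + 1) * (x - c) := by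
    field_simp; ring
  rw [e3] at h1
  have h3 : |a ^ (t % n + 1) * (x - c)| ≤ |a| ^ (n : ℕ) * trackRadius a D X n M s (t / n) := by
    rw [abs_mul, abs_pow]
    gcongr
    · exact ha.le
    · exact hj
  have h4 : W * ∑ i ∈ Finset.range (t % n + 1), |a| ^ i ≤ D := by
    rw [hD]
    gcongr
    exact hj
  have h5 := abs_sub_abs_le_abs_sub (state a b cb (trackPolicy a b D X cb) x₀ w s (t + 1))
    (a ^ (t % n + 1) * (x - c))
  linarith

end Tracking

-- Contraction of the mean-square radius

section SecondMoment

variable {a D X : ℝ} {n : ℕ+} {M : ℕ} (μw : Measure ℝ) [IsProbabilityMeasure μw]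
  {ε : unitInterval}

theorem weighted_sq_add_le {α M e η L D : ℝ} (he : 0 ≤ e) (he1 : e ≤ 1) (hη : 0 < η) :
    e * (α * L + D) ^ 2 + (1 - e) * (α * (L / M) + D) ^ 2 ≤
      (1 + η) * (e * α ^ 2 + (1 - e) * (α ^ 2 / M ^ 2)) * L ^ 2 + (1 + 1 / η) * D ^ 2 := by
  have young : ∀ u : ℝ, (u + D) ^ 2 ≤ (1 + η) * u ^ 2 + (1 + 1 / η) * D ^ 2 := by
    intro u
    have h : (1 + η) * u ^ 2 + (1 + 1 / η) * D ^ 2 - (u + D) ^ 2 = (η * u - D) ^ 2 / η := by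
      field_simp; ring
    have : 0 ≤ (η * u - D) ^ 2 / η := by positivity
    linarith
  have h1 := mul_le_mul_of_nonneg_left (young (α * L)) he
  have h2 := mul_le_mul_of_nonneg_left (young (α * (L / M))) (sub_nonneg.2 he1)
  have e1 : (α * (L / M)) ^ 2 = α ^ 2 / M ^ 2 * L ^ 2 := by ring
  rw [e1] at h2
  nlinarith

/-- The radius depends on the decoding outcomes alone, and that of block `k` is independent of the
radius at `k`; so its second moment obeys an affine recursion with slope `r < 1`. -/
theorem exists_lintegral_trackRadius_le
    (hρ : (ε : ℝ) * a ^ (2 * (n : ℕ)) + (1 - ε) * (a ^ (2 * (n : ℕ)) / (M : ℝ) ^ 2) < 1) :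
    ∃ K : ℝ, ∀ k, ∫⁻ ω, ENNReal.ofReal (trackRadius a D X n M ω.2 k ^ 2) ∂(noiseLaw μw ε) ≤
      ENNReal.ofReal K := by
  have hα2 : a ^ (2 * (n : ℕ)) = (|a| ^ (n : ℕ)) ^ 2 := by
    rw [← pow_mul, mul_comm (n : ℕ) 2, pow_mul |a|, sq_abs, pow_mul]
  rw [hα2] at hρ
  set α := |a| ^ (n : ℕ) with hα
  have hε0 := ε.2.1
  have hε1 := ε.2.2
  set ρ := (ε : ℝ) * α ^ 2 + (1 - ε) * (α ^ 2 / (M : ℝ) ^ 2) with hρdef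
  have hρ0 : 0 ≤ ρ := add_nonneg (by positivity) (mul_nonneg (by linarith) (by positivity))
  -- With this choice `1 - (1 + η) ρ = (1 - ρ) (2 - ρ) / 2 > 0`.
  set η := (1 - ρ) / 2 with hη
  have hη0 : 0 < η := by rw [hη]; linarith
  set r := (1 + η) * ρ with hr
  have hr0 : 0 ≤ r := by positivity
  have hr1 : r < 1 := by rw [hr, hη]; nlinarith
  set B := (1 + 1 / η) * D ^ 2 with hB
  have hB0 : 0 ≤ B := by positivity
  -- The larger of the initial value and the fixed point of `K ↦ r K + B`, hence invariant under the
  -- recursion.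
  set K := max (X ^ 2) (B / (1 - r)) with hK
  have hK0 : 0 ≤ K := (sq_nonneg X).trans (le_max_left _ _)
  have hKB : r * K + B ≤ K := by
    have : B / (1 - r) ≤ K := le_max_right _ _
    rw [div_le_iff₀ (by linarith)] at this
    linarith
  have hmeas : ∀ k, Measurable fun ω : (ℕ → ℝ) × (ℕ → Bool) =>
      ENNReal.ofReal (trackRadius a D X n M ω.2 k ^ 2) := fun k =>
    (((measurable_trackRadius k).comp measurable_snd).pow_const 2).ennreal_ofReal
  refine ⟨K, fun k => ?_⟩
  induction k with
  | zero =>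
    simp only [trackRadius, lintegral_const, measure_univ, mul_one]
    exact ENNReal.ofReal_le_ofReal (le_max_left _ _)
  | succ k ih =>
    rw [lintegral_noiseLaw_update_snd μw ε k (hmeas (k + 1))]
    calc _ ≤ ∫⁻ ω, (ENNReal.ofReal r * ENNReal.ofReal (trackRadius a D X n M ω.2 k ^ 2) +
          ENNReal.ofReal B) ∂(noiseLaw μw ε) := by
          refine lintegral_mono fun ω => ?_
          have hc : ∀ v, trackRadius a D X n M (Function.update ω.2 k v) k =
              trackRadius a D X n M ω.2 k := fun v =>
            trackRadius_congr fun j hj => Function.update_of_ne hj.ne _ _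
          simp only [trackRadius, Function.update_self, hc, if_true, Bool.false_eq_true, if_false]
          rw [← ENNReal.ofReal_mul hε0, ← ENNReal.ofReal_mul (by linarith),
            ← ENNReal.ofReal_mul hr0, ← ENNReal.ofReal_add (by positivity)
              (mul_nonneg (by linarith) (sq_nonneg _)), ← ENNReal.ofReal_add (by positivity) hB0]
          exact ENNReal.ofReal_le_ofReal (weighted_sq_add_le hε0 hε1 hη0)
      _ = ENNReal.ofReal r * ∫⁻ ω, ENNReal.ofReal (trackRadius a D X n M ω.2 k ^ 2)
            ∂(noiseLaw μw ε) + ENNReal.ofReal B := by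
          rw [lintegral_add_right _ measurable_const, lintegral_const_mul _ (hmeas k),
            lintegral_const, measure_univ, mul_one]
      _ ≤ ENNReal.ofReal r * ENNReal.ofReal K + ENNReal.ofReal B := by gcongr
      _ = ENNReal.ofReal (r * K + B) := by
          rw [← ENNReal.ofReal_mul hr0, ← ENNReal.ofReal_add (by positivity) hB0]
      _ ≤ ENNReal.ofReal K := ENNReal.ofReal_le_ofReal hKB

end SecondMoment

theorem averageCost_trackPolicy_lt_top {a b X W D : ℝ} {n : ℕ+} {M : ℕ} [NeZero M]
    (cb : Codebook n M) (μw : Measure ℝ) [IsProbabilityMeasure μw] {ε : unitInterval}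
    (ha : 1 < |a|) (hb : b ≠ 0) (hX : 0 < X) (hW : 0 ≤ W) (hw : ∀ᵐ w ∂μw, |w| ≤ W)
    (hD : D = W * ∑ i ∈ Finset.range n, |a| ^ i)
    (hρ : (ε : ℝ) * a ^ (2 * (n : ℕ)) + (1 - ε) * (a ^ (2 * (n : ℕ)) / (M : ℝ) ^ 2) < 1)
    {x₀ : ℝ} (hx₀ : |x₀| ≤ X) :
    averageCost a b μw ε cb (trackPolicy a b D X cb) x₀ < ⊤ := by
  have ha0 : a ≠ 0 := by rintro rfl; norm_num at ha
  have hD0 : 0 ≤ D := by rw [hD]; positivity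
  obtain ⟨K, hK⟩ := exists_lintegral_trackRadius_le (D := D) (X := X) (n := n) μw hρ
  have hae : ∀ᵐ ω ∂(noiseLaw μw ε), ∀ i, |ω.1 i| ≤ W := by
    refine ae_all_iff.2 fun i => ?_
    have h1 : MeasurePreserving (fun ω : (ℕ → ℝ) × (ℕ → Bool) => ω.1 i) (noiseLaw μw ε) μw :=
      (measurePreserving_eval_infinitePi (fun _ : ℕ => μw) i).comp measurePreserving_fst
    exact h1.quasiMeasurePreserving.ae hw
  set α := |a| ^ (n : ℕ)
  have hbound : ∀ t, ∫⁻ ω, ENNReal.ofReal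
      (state a b cb (trackPolicy a b D X cb) x₀ ω.1 ω.2 (t + 1) ^ 2) ∂(noiseLaw μw ε) ≤
      ENNReal.ofReal (2 * α ^ 2) * ENNReal.ofReal K + ENNReal.ofReal (2 * D ^ 2) := by
    intro t
    have hmeas : Measurable fun ω : (ℕ → ℝ) × (ℕ → Bool) =>
        ENNReal.ofReal (trackRadius a D X n M ω.2 (t / n) ^ 2) :=
      (((measurable_trackRadius _).comp measurable_snd).pow_const 2).ennreal_ofReal
    calc _ ≤ ∫⁻ ω, (ENNReal.ofReal (2 * α ^ 2) *
          ENNReal.ofReal (trackRadius a D X n M ω.2 (t / n) ^ 2) +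
          ENNReal.ofReal (2 * D ^ 2)) ∂(noiseLaw μw ε) := by
          refine lintegral_mono_ae (hae.mono fun ω hω => ?_)
          rw [← ENNReal.ofReal_mul (by positivity), ← ENNReal.ofReal_add (by positivity)
            (by positivity)]
          refine ENNReal.ofReal_le_ofReal ?_
          have h := abs_state_trackPolicy_le cb x₀ ω.1 ω.2 ha hb hW hω hX hx₀ hD t
          rw [← sq_abs]
          refine (pow_le_pow_left₀ (abs_nonneg _) h 2).trans ?_
          nlinarith [sq_nonneg (α * trackRadius a D X n M ω.2 (t / n) - D)]
      _ = ENNReal.ofReal (2 * α ^ 2) * ∫⁻ ω, ENNReal.ofReal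
            (trackRadius a D X n M ω.2 (t / n) ^ 2) ∂(noiseLaw μw ε) +
            ENNReal.ofReal (2 * D ^ 2) := by
          rw [lintegral_add_right _ measurable_const, lintegral_const_mul _ hmeas,
            lintegral_const, measure_univ, mul_one]
      _ ≤ _ := by gcongr; exact hK _
  refine lt_of_le_of_lt (limsup_le_of_le (h := ?_)) (b := ENNReal.ofReal (2 * α ^ 2) *
    ENNReal.ofReal K + ENNReal.ofReal (2 * D ^ 2)) ?_
  · filter_upwards [eventually_ge_atTop 1] with t ht
    obtain ⟨t, rfl⟩ := Nat.exists_eq_add_of_le' ht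
    exact hbound t
  · exact ENNReal.add_lt_top.2 ⟨ENNReal.mul_lt_top ENNReal.ofReal_lt_top ENNReal.ofReal_lt_top,
      ENNReal.ofReal_lt_top⟩

/-! ### The stability region -/

/-- Strict positivity matters because the gain in the necessity argument comes from erasures. -/
theorem qFun_pos (x : ℝ) : 0 < qFun x := by
  have hi : Integrable (fun u : ℝ => Real.exp (-(u ^ 2) / 2)) := by
    refine (integrable_exp_neg_mul_sq (b := 1 / 2) (by norm_num)).congr (ae_of_all _ fun u => ?_)
    show Real.exp _ = Real.exp _
    congr 1
    ring
  refine mul_pos (inv_pos.2 (Real.sqrt_pos.2 (by positivity))) ?_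
  rw [setIntegral_pos_iff_support_of_nonneg_ae (ae_of_all _ fun u => (Real.exp_pos _).le)
    hi.integrableOn]
  have : Function.support (fun u : ℝ => Real.exp (-(u ^ 2) / 2)) = Set.univ :=
    Set.eq_univ_of_forall fun u => (Real.exp_pos _).ne'
  rw [this, Set.univ_inter, Real.volume_Ioi]
  exact ENNReal.zero_lt_top

theorem two_rpow_two_mul_eq_sq {n : ℕ+} {R : ℝ} {M : ℕ} (hM : IsCodebookSize n R M) :
    (2 : ℝ) ^ (2 * (n : ℝ) * R) = (M : ℝ) ^ 2 := by
  rw [hM, ← Real.rpow_natCast, ← Real.rpow_mul (by norm_num)]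
  congr 1
  push_cast
  ring

theorem IsCodebookSize.pos {n : ℕ+} {R : ℝ} {M : ℕ} (hM : IsCodebookSize n R M) : 0 < M := by
  have : (0 : ℝ) < M := by rw [hM]; positivity
  exact_mod_cast this

section Region

variable {a b x0max wmax : ℝ} (μw : Measure ℝ) [IsProbabilityMeasure μw]

theorem mem_stabilityRegion_of_lt_one (ha : 1 < |a|) (hb : b ≠ 0) (hx0 : 0 < x0max)
    (hw : ∀ᵐ w ∂μw, w ∈ Set.Ioo (-wmax) wmax) {ε : ℕ+ → ℝ → unitInterval} {n : ℕ+} {R : ℝ}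
    (hR : 0 < R) {M : ℕ} (hM : IsCodebookSize n R M)
    (hρ : (ε n R : ℝ) * a ^ (2 * (n : ℕ)) +
      (1 - ε n R) * (a ^ (2 * (n : ℕ)) / (2 : ℝ) ^ (2 * (n : ℝ) * R)) < 1) :
    (n, R) ∈ stabilityRegion a b x0max μw ε := by
  have : NeZero M := ⟨hM.pos.ne'⟩
  -- Only distinctness of the codewords is required; constant sequences do.
  let cb : Codebook n M :=
    ⟨fun i _ => ((i : ℕ) : ℂ), fun i j h => Fin.ext (Nat.cast_injective (congrFun h ⟨0, n.pos⟩))⟩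
  rw [two_rpow_two_mul_eq_sq hM] at hρ
  refine ⟨hR, M, hM, cb, trackPolicy a b (|wmax| * ∑ i ∈ Finset.range n, |a| ^ i) x0max cb,
    fun x₀ hx₀ => ?_⟩
  refine averageCost_trackPolicy_lt_top cb μw ha hb hx0 (abs_nonneg wmax)
    (hw.mono fun w h => ?_) rfl hρ (abs_le.2 ⟨hx₀.1.le, hx₀.2.le⟩)
  exact (abs_le.2 ⟨h.1.le, h.2.le⟩).trans (le_abs_self _)

theorem lt_one_of_mem_stabilityRegion (ha : 1 < |a|) (hx0 : 0 < x0max) (hdens : μw ≪ volume)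
    {ε : ℕ+ → ℝ → unitInterval} {n : ℕ+} {R : ℝ} (hε : 0 < (ε n R : ℝ))
    (h : (n, R) ∈ stabilityRegion a b x0max μw ε) :
    (ε n R : ℝ) * a ^ (2 * (n : ℕ)) +
      (1 - ε n R) * (a ^ (2 * (n : ℕ)) / (2 : ℝ) ^ (2 * (n : ℝ) * R)) < 1 := by
  obtain ⟨-, M, hM, cb, π, hπ⟩ := h
  rw [two_rpow_two_mul_eq_sq hM]
  by_contra! hρ
  -- The cost is infinite from every initial state, so the admissible value `0` already gives the
  -- contradiction.
  exact (hπ 0 ⟨by linarith, hx0⟩).ne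
    (averageCost_eq_top a b cb π 0 μw (ε n R) ha hdens hε hM.pos hρ)

end Region

/-- The expression is affine in `e` with slope `a^{2n} - a^{2n} / 2^{2nR} ≥ 0`. No bound on `e` is
needed, so it applies to the approximation shifted by `δ` even outside `[0, 1]`. -/
theorem mem_explicitRegion_mono {a : ℝ} {e e' : ℕ+ → ℝ → ℝ} {n : ℕ+} {R : ℝ}
    (hle : e n R ≤ e' n R) (h : (n, R) ∈ explicitRegion a e') : (n, R) ∈ explicitRegion a e := by
  obtain ⟨hR, hlt⟩ := h
  refine ⟨hR, lt_of_le_of_lt ?_ hlt⟩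
  have h1 : a ^ (2 * (n : ℕ)) / (2 : ℝ) ^ (2 * (n : ℝ) * R) ≤ a ^ (2 * (n : ℕ)) := by
    refine div_le_self (by rw [pow_mul]; positivity) (Real.one_le_rpow (by norm_num) ?_)
    have : 0 < R := hR
    positivity
  dsimp only
  nlinarith

end WNCS

theorem corollary1 (a b x0max wmax snr : ℝ) (ha : 1 < |a|) (hb : b ≠ 0) (hx0 : 0 < x0max)
    (hsnr : 0 < snr)
    (μw : Measure ℝ) [IsProbabilityMeasure μw]
    (hw_bdd : ∀ᵐ w ∂μw, w ∈ Set.Ioo (-wmax) wmax)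
    (hw_mean : ∫ w, w ∂μw = 0)
    (hw_dens : μw ≪ volume) :
    WNCS.stabilityRegion a b x0max μw (WNCS.normalApproxErr snr) =
        WNCS.explicitRegion a (WNCS.normalApprox snr) ∩
          {p | ∃ M : ℕ, WNCS.IsCodebookSize p.1 p.2 M} ∧
      ∀ (ε : ℕ+ → ℝ → unitInterval) (δ : ℕ+ → ℝ → ℝ) (n₀ : ℕ+),
        (∀ n R, n₀ ≤ n → 0 < R → 0 < ε n R ∧ ε n R < 1 ∧
          |(ε n R : ℝ) - WNCS.normalApprox snr n R| ≤ δ n R) →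
        ∀ n R, n₀ ≤ n → 0 < R → (∃ M : ℕ, WNCS.IsCodebookSize n R M) →
          ((n, R) ∈ WNCS.explicitRegion a (fun n R => WNCS.normalApprox snr n R + δ n R) →
            (n, R) ∈ WNCS.stabilityRegion a b x0max μw ε) ∧
          ((n, R) ∈ WNCS.stabilityRegion a b x0max μw ε →
            (n, R) ∈ WNCS.explicitRegion a (fun n R => WNCS.normalApprox snr n R - δ n R)) := by
  refine ⟨?_, fun ε δ n₀ hε n R hn hR hadm => ?_⟩
  · ext ⟨n, R⟩
    constructor
    · intro h
      refine ⟨⟨h.1, ?_⟩, h.2.imp fun M hM => hM.1⟩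
      exact WNCS.lt_one_of_mem_stabilityRegion μw ha hx0 hw_dens (WNCS.qFun_pos _) h
    · rintro ⟨⟨hR, hlt⟩, M, hM⟩
      exact WNCS.mem_stabilityRegion_of_lt_one μw ha hb hx0 hw_bdd hR hM hlt
  · obtain ⟨hε0, -, hδ⟩ := hε n R hn hR
    obtain ⟨hlo, hhi⟩ := abs_le.1 hδ
    obtain ⟨M, hM⟩ := hadm
    constructor
    · intro h
      have h' := WNCS.mem_explicitRegion_mono (e := fun n R => (ε n R : ℝ))
        (by linarith) h
      exact WNCS.mem_stabilityRegion_of_lt_one μw ha hb hx0 hw_bdd hR hM h'.2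
    · intro h
      have h' : (n, R) ∈ WNCS.explicitRegion a (fun n R => (ε n R : ℝ)) :=
        ⟨hR, WNCS.lt_one_of_mem_stabilityRegion μw ha hx0 hw_dens hε0 h⟩
      exact WNCS.mem_explicitRegion_mono (by linarith) h'
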